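/- Let $\gamma>0$ and let $u\in C^0((-\infty,0])$ be real-valued and such that $t\mapsto e^{\gamma t}u(t)$ is bounded on $(-\infty,0]$. Consider, without initial condition, the problem $$\partial_t w(t,\lambda)=\partial_\lambda^2 w(t,\lambda)-\gamma w(t,\lambda)\quad (t\le 0,\ 0\le\lambda<1),\qquad \partial_\lambda w(t,0)=0,\quad w(t,1)=u(t)\quad (t\le 0).$$ A classical solution is a function $w$, continuous on $(-\infty,0]\times[0,1]$, that satisfies these equations and belongs to $C^1((-\infty,0],C^2([0,1)))$, i.e. to $C^1((-\infty,0],C^2([0,r]))$ for every $0<r<1$ (derivatives at end points being one-sided; $C^m(I,\mathcal B)$ denotes the $m$ times continuously Fréchet differentiable functions from $I$ to the Banach space $\mathcal B$). Then there is exactly one classical solution $w_u$ for which there exists $C>0$ such that $\|w_u(t,\cdot)\|_{L^2(0,1)}<Ce^{-\gamma t}$ for all $t\le 0$. Moreover, for every $t\le 0$, $w_u(t,\cdot)\in\mathcal A$, where $\mathcal A$ is the space of functions $v\in L^2(0,1)$ that are analytic on $[0,1)$ and satisfy $\frac{d^{2k+1}v}{d\lambda^{2k+1}}(0)=0$ for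 all $k\in\mathbb N$. Finally, the regularity of $w_u$ extends up to $\lambda=1$, in the sense that $w_u\in C^1((-\infty,0],C^2([0,1]))$, if and only if $u\in C^2((-\infty,0])$. -/

import Mathlib

open Set MeasureTheory

namespace SteadyHeat

/-- `w ∈ C¹((-∞, 0], C²([0, r]))` (Fréchet differentiability in the Banach space `C²([0, r])`).
Since `v ↦ (v, v', v'')` embeds `C²([0, r])`, with its usual norm, as a closed subspace of
`C([0, r])³`, this says that `t ↦ ∂ₓʲ w(t, ·)`, for `j = 0, 1, 2`, are `C¹` maps
from `(-∞, 0]` to `C([0, r])` with the sup norm. Derivatives at end points are one-sided. -/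
def MemC1C2 (w : ℝ → ℝ → ℝ) (r : ℝ) : Prop :=
  (∀ t ≤ 0, ContDiffOn ℝ 2 (w t) (Icc 0 r)) ∧
  ∀ j : ℕ, j ≤ 2 → ∃ W : ℝ → C(Icc (0 : ℝ) r, ℝ),
    ContDiffOn ℝ 1 W (Iic 0) ∧
    ∀ t ≤ 0, ∀ x : Icc (0 : ℝ) r, W t x = iteratedDerivWithin j (w t) (Icc 0 r) x

/-- Classical solutions `w`, on `(-∞, 0] × [0, 1]`, of
`∂ₜ w = ∂ₓ² w - γ w`, `∂ₓ w(t, 0) = 0`, `w(t, 1) = u(t)`: continuous up to the boundary `x = 1`,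
and `C¹` in time with values in `C²([0, 1))`, that is in `C²([0, r])` for every `r < 1`. -/
structure IsClassicalSolution (γ : ℝ) (u : ℝ → ℝ) (w : ℝ → ℝ → ℝ) : Prop where
  continuousOn : ContinuousOn (fun p : ℝ × ℝ => w p.1 p.2) (Iic 0 ×ˢ Icc 0 1)
  memC1C2 : ∀ r : ℝ, 0 < r → r < 1 → MemC1C2 w r
  heat : ∀ t ≤ 0, ∀ x ∈ Ico (0 : ℝ) 1,
    derivWithin (fun s => w s x) (Iic 0) t
      = iteratedDerivWithin 2 (w t) (Ico 0 1) x - γ * w t x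
  neumann : ∀ t ≤ 0, derivWithin (w t) (Ico 0 1) 0 = 0
  dirichlet : ∀ t ≤ 0, w t 1 = u t

/-- There is `C > 0` with `‖w(t, ·)‖_{L²(0,1)} < C e^{-γ t}` for all `t ≤ 0`. -/
def HasL2Bound (γ : ℝ) (w : ℝ → ℝ → ℝ) : Prop :=
  ∃ C : ℝ, 0 < C ∧ ∀ t ≤ 0,
    eLpNorm (w t) 2 (volume.restrict (Ioo 0 1)) < ENNReal.ofReal (C * Real.exp (-γ * t))

/-- The space `𝒜` of functions in `L²(0,1)`, analytic on `[0, 1)`, all of whose derivatives of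
odd order vanish at `0`. -/
def spaceA : Set (ℝ → ℝ) :=
  {v | MemLp v 2 (volume.restrict (Ioo 0 1)) ∧ AnalyticOn ℝ v (Ico 0 1) ∧
    ∀ k : ℕ, iteratedDerivWithin (2 * k + 1) v (Ico 0 1) 0 = 0}

end SteadyHeat

/-!
Multiplication by `e^{γ t}` turns the problem into the undamped heat equation on the strip
`-1 < x < 1`, with bounded boundary data `g t = e^{γ t} u t` at `x = ± 1`.

*Existence.* A bounded density `φ`, prescribed at `x = 0` for all times up to `t`, determines a
bounded solution of the heat equation in the half-line `x > 0`, the average of `φ` against the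
hitting-time density at distance `x`. The sum of two such solutions, one issuing from `x = 1` and
the other from its mirror image `x = -1`, is even in `x` and takes the boundary values
`φ + T φ`, where `T` averages against the hitting-time density at distance `2`. As `‖T‖ = 1`, the
equation `φ + T φ = g` is not solved by a Neumann series; but the kernels of `T` and `T²` overlap,
so that `‖T - T²‖ < 2`, and this suffices for `1 + T` to be invertible. Analyticity in `x` is
inherited from the kernel.

*Uniqueness.* The difference of two solutions is tested against `cos ((n + 1/2) π x / r)` on
`[0, r]`. Letting `r → 1` shows that the coefficients decay exponentially in time; as they are
bounded, sending the initial time to `-∞` makes them vanish.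

*Regularity up to `x = 1`.* If `w` is regular up to `x = 1`, then its trace `u` satisfies
`∂ₜ u = ∂ₓ² w(·, 1) - γ u`, whose right-hand side is `C¹`. Conversely, if `u` is `C²` then so is
the density `φ`, hence `t ↦ w(t, ·)` is `C²` with values in `C([0, 1])`, and the heat equation
trades time derivatives for space derivatives.
-/

namespace SteadyHeat

open Filter Topology BoundedContinuousFunction
open scoped ContDiff

/-! ### Gaussian kernels -/

/-- The kernel `τ ^ (-m / 2) * exp (-y ^ 2 / (4 τ))` at `p = (τ, y)`. For `m ≠ 0` the junk value
`(√τ)⁻¹ = 0` makes it vanish for `τ ≤ 0`, so that it is smooth away from the origin. -/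
noncomputable def parabolicKernel (m : ℕ) (p : ℝ × ℝ) : ℝ :=
  (√p.1)⁻¹ ^ m * Real.exp (-(p.2 * (√p.1)⁻¹) ^ 2 / 4)

theorem parabolicKernel_nonneg (m : ℕ) (p : ℝ × ℝ) : 0 ≤ parabolicKernel m p := by
  unfold parabolicKernel; positivity

theorem parabolicKernel_of_nonpos {m : ℕ} (hm : m ≠ 0) {p : ℝ × ℝ} (hp : p.1 ≤ 0) :
    parabolicKernel m p = 0 := by
  simp [parabolicKernel, Real.sqrt_eq_zero_of_nonpos hp, hm]

@[fun_prop]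
theorem measurable_parabolicKernel (m : ℕ) : Measurable (parabolicKernel m) := by
  unfold parabolicKernel; fun_prop

theorem parabolicKernel_add (m n : ℕ) (p : ℝ × ℝ) :
    parabolicKernel (m + n) p = (√p.1)⁻¹ ^ m * parabolicKernel n p := by
  unfold parabolicKernel; ring

theorem parabolicKernel_le_inv_sqrt_pow (m : ℕ) (p : ℝ × ℝ) :
    parabolicKernel m p ≤ (√p.1)⁻¹ ^ m := by
  refine mul_le_of_le_one_right (by positivity) (Real.exp_le_one_iff.2 ?_)
  linarith [sq_nonneg (p.2 * (√p.1)⁻¹)]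

theorem pow_mul_exp_neg_sq_le (m : ℕ) {δ y : ℝ} (hδ : 0 < δ) (ρ : ℝ) (hy : δ ≤ |y|) :
    ρ ^ m * Real.exp (-(y * ρ) ^ 2 / 4) ≤ 1 + (4 / δ ^ 2) ^ m * m.factorial := by
  rw [neg_div, Real.exp_neg, ← div_eq_mul_inv, div_le_iff₀ (Real.exp_pos _)]
  have hexp : (δ ^ 2 * ρ ^ 2 / 4) ^ m ≤ m.factorial * Real.exp ((y * ρ) ^ 2 / 4) := by
    rw [← div_le_iff₀' (by positivity)]
    refine (Real.pow_div_factorial_le_exp _ (by positivity) m).trans (Real.exp_le_exp.2 ?_)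
    rw [mul_pow y, ← sq_abs y]
    gcongr
  calc ρ ^ m ≤ 1 + (ρ ^ m) ^ 2 := by nlinarith [sq_nonneg (ρ ^ m - 1)]
    _ = 1 + (4 / δ ^ 2) ^ m * (δ ^ 2 * ρ ^ 2 / 4) ^ m := by
        rw [← mul_pow, ← pow_mul, mul_comm m, pow_mul]
        field_simp
    _ ≤ Real.exp ((y * ρ) ^ 2 / 4)
          + (4 / δ ^ 2) ^ m * (m.factorial * Real.exp ((y * ρ) ^ 2 / 4)) := by
        gcongr
        exact Real.one_le_exp (by positivity)
    _ = (1 + (4 / δ ^ 2) ^ m * m.factorial) * Real.exp ((y * ρ) ^ 2 / 4) := by ring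

theorem exists_parabolicKernel_le (m : ℕ) {δ : ℝ} (hδ : 0 < δ) :
    ∃ C, 0 ≤ C ∧ ∀ p, δ ≤ ‖p‖ → parabolicKernel m p ≤ C := by
  refine ⟨1 + (4 / δ ^ 2) ^ m * m.factorial + (√δ)⁻¹ ^ m, by positivity, fun p hp => ?_⟩
  have hδm : 0 ≤ (√δ)⁻¹ ^ m := by positivity
  have hfar : 0 ≤ (4 / δ ^ 2) ^ m * m.factorial := by positivity
  have hpow := parabolicKernel_le_inv_sqrt_pow m p
  rcases le_or_gt p.1 0 with hτ | hτ
  · rw [Real.sqrt_eq_zero_of_nonpos hτ, inv_zero] at hpow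
    linarith [pow_le_one₀ (n := m) le_rfl (zero_le_one (α := ℝ))]
  rw [Prod.norm_def] at hp
  rcases le_max_iff.1 hp with h | h
  · rw [Real.norm_of_nonneg hτ.le] at h
    have : (√p.1)⁻¹ ^ m ≤ (√δ)⁻¹ ^ m := by gcongr
    linarith
  · have : parabolicKernel m p ≤ _ := pow_mul_exp_neg_sq_le m hδ _ h
    linarith

/-- The integrable weight `(1 + |s|) ^ (-3 / 2)`, which dominates the kernels `parabolicKernel m`
with `3 ≤ m` away from the origin. -/
noncomputable def timeWeight (s : ℝ) : ℝ := (√(1 + |s|))⁻¹ ^ 3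

theorem timeWeight_pos (s : ℝ) : 0 < timeWeight s := by
  unfold timeWeight; positivity

theorem integrable_timeWeight : Integrable timeWeight := by
  refine (integrable_one_add_norm (E := ℝ) (r := 3 / 2) (by norm_num)).congr
    (Eventually.of_forall fun s => ?_)
  have h : 0 ≤ 1 + |s| := by positivity
  simp only [timeWeight, Real.norm_eq_abs, Real.sqrt_eq_rpow]
  rw [← Real.rpow_neg h, ← Real.rpow_mul_natCast h]
  norm_num

theorem timeWeight_sub_le (t s : ℝ) : timeWeight (t - s) ≤ √(1 + |t|) ^ 3 * timeWeight s := by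
  have hadd : 1 + |s| ≤ (1 + |t|) * (1 + |t - s|) := by
    have : |s| ≤ |t| + |t - s| := by simpa using abs_sub t (t - s)
    nlinarith [abs_nonneg t, abs_nonneg (t - s)]
  have hsqrt : √(1 + |s|) ≤ √(1 + |t|) * √(1 + |t - s|) := by
    rw [← Real.sqrt_mul (by positivity)]
    exact Real.sqrt_le_sqrt hadd
  rw [timeWeight, timeWeight, ← mul_pow, ← div_eq_mul_inv]
  gcongr
  rw [inv_le_comm₀ (by positivity) (by positivity), inv_div, div_le_iff₀ (by positivity)]
  linarith

theorem exists_parabolicKernel_le_timeWeight {m : ℕ} (hm : 3 ≤ m) {δ : ℝ} (hδ : 0 < δ) :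
    ∃ C, 0 ≤ C ∧ ∀ p, δ ≤ ‖p‖ → parabolicKernel m p ≤ C * timeWeight p.1 := by
  obtain ⟨C, hC0, hC⟩ := exists_parabolicKernel_le m hδ
  obtain ⟨C', hC'0, hC'⟩ := exists_parabolicKernel_le (m - 3) hδ
  refine ⟨4 * (C + C'), by positivity, fun p hp => ?_⟩
  rcases le_or_gt p.1 0 with hτ | hτ
  · rw [parabolicKernel_of_nonpos (by omega) hτ]
    exact mul_nonneg (by positivity) (timeWeight_pos _).le
  have hsqrt : √(1 + |p.1|) ^ 3 ≤ 4 * (1 + √p.1 ^ 3) := by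
    have hle : √(1 + |p.1|) ≤ 1 + √p.1 := by
      rw [abs_of_pos hτ, Real.sqrt_le_left (by positivity)]
      nlinarith [Real.sq_sqrt hτ.le, Real.sqrt_nonneg p.1]
    calc √(1 + |p.1|) ^ 3 ≤ (1 + √p.1) ^ 3 := by gcongr
      _ ≤ 2 ^ (3 - 1) * (1 ^ 3 + √p.1 ^ 3) := add_pow_le zero_le_one (Real.sqrt_nonneg _) 3
      _ = 4 * (1 + √p.1 ^ 3) := by norm_num
  have hshift : parabolicKernel m p * √p.1 ^ 3 = parabolicKernel (m - 3) p := by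
    have := Real.sqrt_pos.2 hτ
    conv_lhs => rw [← Nat.add_sub_cancel' hm, parabolicKernel_add]
    field_simp
  rw [timeWeight, inv_pow, ← div_eq_mul_inv, le_div_iff₀ (by positivity)]
  calc parabolicKernel m p * √(1 + |p.1|) ^ 3
      ≤ parabolicKernel m p * (4 * (1 + √p.1 ^ 3)) :=
        mul_le_mul_of_nonneg_left hsqrt (parabolicKernel_nonneg m p)
    _ = 4 * (parabolicKernel m p + parabolicKernel (m - 3) p) := by rw [← hshift]; ring
    _ ≤ 4 * (C + C') := by gcongr <;> [exact hC p hp; exact hC' p hp]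

/-- The coefficient of `parabolicKernel (m + 2)` in the derivative of `parabolicKernel m`. -/
noncomputable def fderivCoeffTwo (m : ℕ) (y : ℝ) : ℝ × ℝ →L[ℝ] ℝ :=
  -(m / 2 : ℝ) • ContinuousLinearMap.fst ℝ ℝ ℝ - (y / 2) • ContinuousLinearMap.snd ℝ ℝ ℝ

/-- The coefficient of `parabolicKernel (m + 4)` in the derivative of `parabolicKernel m`. -/
noncomputable def fderivCoeffFour (y : ℝ) : ℝ × ℝ →L[ℝ] ℝ :=
  (y ^ 2 / 4) • ContinuousLinearMap.fst ℝ ℝ ℝ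

@[fun_prop]
theorem contDiff_fderivCoeffTwo (m : ℕ) {n : WithTop ℕ∞} : ContDiff ℝ n (fderivCoeffTwo m) := by
  unfold fderivCoeffTwo; fun_prop

@[fun_prop]
theorem contDiff_fderivCoeffFour {n : WithTop ℕ∞} : ContDiff ℝ n fderivCoeffFour := by
  unfold fderivCoeffFour; fun_prop

theorem hasFDerivAt_parabolicKernel_of_pos (m : ℕ) {p : ℝ × ℝ} (hp : 0 < p.1) :
    HasFDerivAt (parabolicKernel m)
      (parabolicKernel (m + 2) p • fderivCoeffTwo m p.2
        + parabolicKernel (m + 4) p • fderivCoeffFour p.2) p := by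
  have hs : 0 < √p.1 := Real.sqrt_pos.2 hp
  have hinv : HasFDerivAt (fun q : ℝ × ℝ => (√q.1)⁻¹)
      ((-(√p.1)⁻¹ ^ 3 / 2) • ContinuousLinearMap.fst ℝ ℝ ℝ) p := by
    refine (((Real.hasDerivAt_sqrt hp.ne').inv hs.ne').comp_hasFDerivAt p
      hasFDerivAt_fst).congr_fderiv ?_
    congr 1
    field_simp
  have hexp := ((((hasFDerivAt_snd (p := p)).mul hinv).pow 2).neg.mul_const (1 / 4)).exp
  refine (((hinv.pow m).mul hexp).congr_fderiv ?_).congr_of_eventuallyEq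
    (Eventually.of_forall fun q => ?_)
  · ext
    · rcases m with _ | m <;>
      · simp [fderivCoeffTwo, fderivCoeffFour, parabolicKernel]
        ring_nf
    · simp [fderivCoeffTwo, fderivCoeffFour, parabolicKernel]
      ring_nf
  · simp [parabolicKernel, div_eq_mul_inv]

theorem hasFDerivAt_parabolicKernel {m : ℕ} (hm : m ≠ 0) {p : ℝ × ℝ} (hp : p ≠ 0) :
    HasFDerivAt (parabolicKernel m)
      (parabolicKernel (m + 2) p • fderivCoeffTwo m p.2
        + parabolicKernel (m + 4) p • fderivCoeffFour p.2) p := by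
  rcases lt_or_ge 0 p.1 with hτ | hτ
  · exact hasFDerivAt_parabolicKernel_of_pos m hτ
  -- The kernel is `O(τ ^ 2)` for `τ > 0` and vanishes for `τ ≤ 0`.
  simp only [parabolicKernel_of_nonpos (show m + 2 ≠ 0 by omega) hτ,
    parabolicKernel_of_nonpos (show m + 4 ≠ 0 by omega) hτ, zero_smul, add_zero]
  obtain ⟨C, hC0, hC⟩ := exists_parabolicKernel_le (m + 4) (half_pos (norm_pos_iff.2 hp))
  refine Asymptotics.IsBigO.hasFDerivAt (n := 2) (Asymptotics.IsBigO.of_bound C ?_) one_lt_two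
  filter_upwards [(continuous_norm.tendsto p).eventually
    (lt_mem_nhds (half_lt_self (norm_pos_iff.2 hp)))] with q hq
  rw [Real.norm_of_nonneg (parabolicKernel_nonneg _ _), Real.norm_of_nonneg (by positivity)]
  rcases le_or_gt q.1 0 with hq0 | hq0
  · rw [parabolicKernel_of_nonpos hm hq0]; positivity
  have hle : q.1 ≤ ‖q - p‖ := by
    have : |q.1 - p.1| ≤ ‖q - p‖ := norm_fst_le (q - p)
    linarith [le_abs_self (q.1 - p.1)]
  calc parabolicKernel m q = parabolicKernel (m + 4) q * q.1 ^ 2 := by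
        have := Real.sqrt_pos.2 hq0
        have hsq : q.1 ^ 2 = √q.1 ^ 4 := by
          conv_lhs => rw [← Real.sq_sqrt hq0.le]
          ring
        rw [add_comm m, parabolicKernel_add, hsq]
        field_simp
    _ ≤ C * ‖q - p‖ ^ 2 := by gcongr; exact hC q hq.le

/-! ### Heat potentials -/

theorem exists_eventually_norm_smul_le {X 𝕜 E : Type*} [TopologicalSpace X] [NormedField 𝕜]
    [SeminormedAddCommGroup E] [NormedSpace 𝕜 E] {f : X → ℝ → 𝕜} {A : X → E} {w : ℝ → ℝ} {p : X}
    (hf : ∃ C, ∀ᶠ q in 𝓝 p, ∀ s, ‖f q s‖ ≤ C * w s) (hA : Continuous A) :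
    ∃ C, ∀ᶠ q in 𝓝 p, ∀ s, ‖f q s • A q‖ ≤ C * w s := by
  obtain ⟨C, hC⟩ := hf
  refine ⟨C * (‖A p‖ + 1), ?_⟩
  filter_upwards [hC, (hA.norm.tendsto p).eventually (gt_mem_nhds (lt_add_one _))] with q hq hAq s
  calc ‖f q s • A q‖ = ‖f q s‖ * ‖A q‖ := norm_smul _ _
    _ ≤ C * w s * (‖A p‖ + 1) :=
        mul_le_mul (hq s) hAq.le (norm_nonneg _) ((norm_nonneg _).trans (hq s))
    _ = C * (‖A p‖ + 1) * w s := by ring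

/-- The potential, at the point `p = (t, y)`, of the density `φ` on the time axis `y = 0`. -/
noncomputable def potential (m : ℕ) (φ : ℝ → ℝ) (p : ℝ × ℝ) : ℝ :=
  ∫ s, parabolicKernel m (p - (s, 0)) * φ s

section Potential

variable {φ : ℝ → ℝ} {B : ℝ} {m : ℕ} {p : ℝ × ℝ}

theorem aestronglyMeasurable_potential_integrand (hφm : Measurable φ) (m : ℕ) (p : ℝ × ℝ) :
    AEStronglyMeasurable fun s => parabolicKernel m (p - (s, 0)) * φ s := by
  have : Measurable fun s : ℝ => parabolicKernel m (p - (s, 0)) :=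
    (measurable_parabolicKernel m).comp (by fun_prop)
  exact (this.mul hφm).aestronglyMeasurable

theorem exists_eventually_le_norm_sub_tsupport (hp : p ∉ tsupport φ ×ˢ {0}) :
    ∃ δ > 0, ∀ᶠ q in 𝓝 p, ∀ s, φ s ≠ 0 → δ ≤ ‖q - (s, 0)‖ := by
  have hclosed : IsClosed (tsupport φ ×ˢ {(0 : ℝ)}) :=
    (isClosed_tsupport φ).prod isClosed_singleton
  obtain ⟨ε, hε, hball⟩ := Metric.isOpen_iff.1 hclosed.isOpen_compl p hp
  refine ⟨ε / 2, by positivity, ?_⟩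
  filter_upwards [Metric.ball_mem_nhds p (half_pos hε)] with q hq s hs
  have hfar : ε ≤ dist (s, (0 : ℝ)) p := by
    by_contra! h
    exact hball (Metric.mem_ball.2 h) ⟨subset_tsupport φ hs, rfl⟩
  rw [Metric.mem_ball] at hq
  rw [← dist_eq_norm]
  linarith [dist_triangle (s, (0 : ℝ)) q p, dist_comm (s, (0 : ℝ)) q]

theorem exists_eventually_norm_kernel_mul_le (hm : 3 ≤ m) (hφ : ∀ s, |φ s| ≤ B)
    (hp : p ∉ tsupport φ ×ˢ {0}) :
    ∃ C, ∀ᶠ q in 𝓝 p, ∀ s, ‖parabolicKernel m (q - (s, 0)) * φ s‖ ≤ C * timeWeight s := by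
  obtain ⟨δ, hδ, hfar⟩ := exists_eventually_le_norm_sub_tsupport hp
  obtain ⟨C, hC0, hC⟩ := exists_parabolicKernel_le_timeWeight hm hδ
  have hB : 0 ≤ B := (abs_nonneg _).trans (hφ 0)
  refine ⟨C * √(1 + (|p.1| + 1)) ^ 3 * B, ?_⟩
  have htime : ∀ᶠ q : ℝ × ℝ in 𝓝 p, |q.1| < |p.1| + 1 :=
    (continuous_fst.abs.tendsto p).eventually (gt_mem_nhds (lt_add_one _))
  filter_upwards [hfar, htime] with q hq ht s
  have hw := (timeWeight_pos s).le
  by_cases h0 : φ s = 0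
  · simp only [h0, mul_zero, norm_zero]; positivity
  rw [norm_mul, Real.norm_of_nonneg (parabolicKernel_nonneg _ _), Real.norm_eq_abs]
  calc parabolicKernel m (q - (s, 0)) * |φ s|
      ≤ C * timeWeight (q.1 - s) * B := by
        gcongr
        · exact mul_nonneg hC0 (timeWeight_pos _).le
        · exact hC _ (hq s h0)
        · exact hφ s
    _ ≤ C * (√(1 + (|p.1| + 1)) ^ 3 * timeWeight s) * B := by
        gcongr
        exact (timeWeight_sub_le _ _).trans (by gcongr)
    _ = C * √(1 + (|p.1| + 1)) ^ 3 * B * timeWeight s := by ring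

theorem integrable_potential_integrand (hm : 3 ≤ m) (hφm : Measurable φ) (hφ : ∀ s, |φ s| ≤ B)
    (hp : p ∉ tsupport φ ×ˢ {0}) :
    Integrable fun s => parabolicKernel m (p - (s, 0)) * φ s := by
  obtain ⟨C, hC⟩ := exists_eventually_norm_kernel_mul_le hm hφ hp
  exact (integrable_timeWeight.const_mul C).mono' (aestronglyMeasurable_potential_integrand hφm m p)
    (Eventually.of_forall hC.self_of_nhds)

theorem hasFDerivAt_potential_integrand (hm : m ≠ 0) {s : ℝ} (h : φ s ≠ 0 → p ≠ (s, 0)) :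
    HasFDerivAt (fun q => parabolicKernel m (q - (s, 0)) * φ s)
      ((parabolicKernel (m + 2) (p - (s, 0)) * φ s) • fderivCoeffTwo m p.2
        + (parabolicKernel (m + 4) (p - (s, 0)) * φ s) • fderivCoeffFour p.2) p := by
  by_cases h0 : φ s = 0
  · simpa only [h0, mul_zero, zero_smul, add_zero] using hasFDerivAt_const (0 : ℝ) p
  have hk := (hasFDerivAt_parabolicKernel hm (sub_ne_zero.2 (h h0))).comp p
    ((hasFDerivAt_id p).sub_const _)
  refine (hk.mul_const (φ s)).congr_fderiv ?_
  simp only [ContinuousLinearMap.comp_id, Prod.snd_sub, sub_zero, smul_add, smul_smul,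
    mul_comm (φ s)]

theorem exists_eventually_norm_fderiv_integrand_le (hm : 3 ≤ m) (hφ : ∀ s, |φ s| ≤ B)
    (hp : p ∉ tsupport φ ×ˢ {0}) :
    ∃ C, ∀ᶠ q in 𝓝 p, ∀ s, ‖(parabolicKernel (m + 2) (q - (s, 0)) * φ s) • fderivCoeffTwo m q.2
      + (parabolicKernel (m + 4) (q - (s, 0)) * φ s) • fderivCoeffFour q.2‖
        ≤ C * timeWeight s := by
  obtain ⟨C₂, h₂⟩ := exists_eventually_norm_smul_le
    (exists_eventually_norm_kernel_mul_le (m := m + 2) (by omega) hφ hp)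
    (by fun_prop : Continuous fun q : ℝ × ℝ => fderivCoeffTwo m q.2)
  obtain ⟨C₄, h₄⟩ := exists_eventually_norm_smul_le
    (exists_eventually_norm_kernel_mul_le (m := m + 4) (by omega) hφ hp)
    (by fun_prop : Continuous fun q : ℝ × ℝ => fderivCoeffFour q.2)
  refine ⟨C₂ + C₄, ?_⟩
  filter_upwards [h₂, h₄] with q hq₂ hq₄ s
  rw [add_mul]
  exact norm_add_le_of_le (hq₂ s) (hq₄ s)

theorem hasFDerivAt_potential (hm : 3 ≤ m) (hφm : Measurable φ) (hφ : ∀ s, |φ s| ≤ B)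
    (hp : p ∉ tsupport φ ×ˢ {0}) :
    HasFDerivAt (potential m φ)
      (potential (m + 2) φ p • fderivCoeffTwo m p.2
        + potential (m + 4) φ p • fderivCoeffFour p.2) p := by
  obtain ⟨δ, hδ, hfar⟩ := exists_eventually_le_norm_sub_tsupport hp
  obtain ⟨C, hC⟩ := exists_eventually_norm_fderiv_integrand_le hm hφ hp
  have hi₂ := (integrable_potential_integrand (m := m + 2) (by omega) hφm hφ hp).smul_const
    (fderivCoeffTwo m p.2)
  have hi₄ := (integrable_potential_integrand (m := m + 4) (by omega) hφm hφ hp).smul_const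
    (fderivCoeffFour p.2)
  have hderiv : ∀ s, ∀ q ∈ {q : ℝ × ℝ | ∀ s, φ s ≠ 0 → δ ≤ ‖q - (s, 0)‖}, HasFDerivAt _ _ q :=
    fun s q hq => hasFDerivAt_potential_integrand (φ := φ) (m := m) (s := s) (by omega)
      fun h0 heq => hδ.not_ge (by simpa [heq] using hq s h0)
  refine (hasFDerivAt_integral_of_dominated_of_fderiv_le (hfar.and hC)
    (Eventually.of_forall fun q => aestronglyMeasurable_potential_integrand hφm m q)
    (integrable_potential_integrand hm hφm hφ hp) (hi₂.add hi₄).aestronglyMeasurable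
    (Eventually.of_forall fun s q hq => hq.2 s) (integrable_timeWeight.const_mul C)
    (Eventually.of_forall fun s q hq => hderiv s q hq.1)).congr_fderiv ?_
  rw [integral_add hi₂ hi₄, integral_smul_const, integral_smul_const, potential, potential]

theorem contDiffOn_potential (hm : 3 ≤ m) (hφm : Measurable φ) (hφ : ∀ s, |φ s| ≤ B) :
    ContDiffOn ℝ ∞ (potential m φ) (tsupport φ ×ˢ {0})ᶜ := by
  have hopen : IsOpen (tsupport φ ×ˢ {(0 : ℝ)})ᶜ :=
    ((isClosed_tsupport φ).prod isClosed_singleton).isOpen_compl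
  refine contDiffOn_infty.2 fun n => ?_
  induction n generalizing m with
  | zero => exact contDiffOn_zero.2 fun p hp =>
      (hasFDerivAt_potential hm hφm hφ hp).continuousAt.continuousWithinAt
  | succ n ih =>
    refine (contDiffOn_succ_iff_fderiv_of_isOpen hopen).2 ⟨fun p hp =>
      (hasFDerivAt_potential hm hφm hφ hp).differentiableAt.differentiableWithinAt,
      fun h => absurd h (WithTop.natCast_ne_top n), ?_⟩
    have h₂ := ih (m := m + 2) (by omega)
    have h₄ := ih (m := m + 4) (by omega)
    exact ContDiffOn.congr (by fun_prop) fun p hp => (hasFDerivAt_potential hm hφm hφ hp).fderiv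

end Potential

/-! ### Analyticity of the potentials in the space variable -/

/-- The extension of `y ↦ parabolicKernel m (τ, y)` to complex `y`. -/
noncomputable def complexKernel (m : ℕ) (τ : ℝ) (z : ℂ) : ℂ :=
  (((√τ)⁻¹ : ℝ) : ℂ) ^ m * Complex.exp (-(z * ((√τ)⁻¹ : ℝ)) ^ 2 / 4)

theorem complexKernel_ofReal (m : ℕ) (τ y : ℝ) :
    complexKernel m τ y = (parabolicKernel m (τ, y) : ℂ) := by
  simp [complexKernel, parabolicKernel]

@[fun_prop]
theorem measurable_complexKernel (m : ℕ) (z : ℂ) : Measurable fun τ => complexKernel m τ z := by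
  unfold complexKernel; fun_prop

theorem norm_complexKernel (m : ℕ) (τ : ℝ) {z : ℂ} (hz : 0 ≤ (z ^ 2).re) :
    ‖complexKernel m τ z‖ = parabolicKernel m (τ, √(z ^ 2).re) := by
  have hre : (-(z * ((√τ)⁻¹ : ℝ)) ^ 2 / 4).re = -(√(z ^ 2).re * (√τ)⁻¹) ^ 2 / 4 := by
    rw [mul_pow, mul_pow, Real.sq_sqrt hz, ← Complex.ofReal_pow, Complex.div_ofNat_re,
      Complex.neg_re, Complex.re_mul_ofReal]
  rw [complexKernel, parabolicKernel, norm_mul, Complex.norm_exp, hre, norm_pow,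
    Complex.norm_real, Real.norm_of_nonneg (by positivity)]

theorem hasDerivAt_complexKernel (m : ℕ) (τ : ℝ) (z : ℂ) :
    HasDerivAt (complexKernel m τ) (complexKernel (m + 2) τ z * (-z / 2)) z := by
  have h := ((((hasDerivAt_id z).mul_const (((√τ)⁻¹ : ℝ) : ℂ)).pow 2).neg.div_const 4).cexp
  refine (h.const_mul ((((√τ)⁻¹ : ℝ) : ℂ) ^ m)).congr_deriv ?_
  simp only [id_eq, Nat.cast_ofNat, complexKernel, Pi.neg_apply, Pi.pow_apply]
  ring

section Potential

variable {φ : ℝ → ℝ} {B : ℝ} {m : ℕ}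

theorem exists_eventually_norm_complexKernel_mul_le (hm : 3 ≤ m) (hφ : ∀ s, |φ s| ≤ B) (t : ℝ)
    {z : ℂ} (hz : 0 < (z ^ 2).re) :
    ∃ C, ∀ᶠ w in 𝓝 z, ∀ s, ‖complexKernel m (t - s) w * φ s‖ ≤ C * timeWeight s := by
  have hz0 : (t, √(z ^ 2).re) ∉ tsupport φ ×ˢ {(0 : ℝ)} := fun h => (Real.sqrt_pos.2 hz).ne' h.2
  obtain ⟨C, hC⟩ := exists_eventually_norm_kernel_mul_le hm hφ hz0
  have hcont : Continuous fun w : ℂ => (t, √(w ^ 2).re) := by fun_prop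
  have hre : Continuous fun w : ℂ => (w ^ 2).re := by fun_prop
  refine ⟨C, ?_⟩
  filter_upwards [(hcont.tendsto z).eventually hC,
    (hre.tendsto z).eventually (lt_mem_nhds hz)] with w hw hw0 s
  have := hw s
  rw [norm_mul, Real.norm_of_nonneg (parabolicKernel_nonneg _ _)] at this
  rw [norm_mul, norm_complexKernel m _ hw0.le, Complex.norm_real]
  simpa using this

theorem differentiableAt_integral_complexKernel (hm : 3 ≤ m) (hφm : Measurable φ)
    (hφ : ∀ s, |φ s| ≤ B) (t : ℝ) {z : ℂ} (hz : 0 < (z ^ 2).re) :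
    DifferentiableAt ℂ (fun z => ∫ s, complexKernel m (t - s) z * φ s) z := by
  have hmeas (k : ℕ) (w : ℂ) : AEStronglyMeasurable fun s => complexKernel k (t - s) w * φ s :=
    Measurable.aestronglyMeasurable (by fun_prop)
  obtain ⟨C, hC⟩ := exists_eventually_norm_complexKernel_mul_le hm hφ t hz
  obtain ⟨C', hC'⟩ := exists_eventually_norm_smul_le
    (exists_eventually_norm_complexKernel_mul_le (m := m + 2) (by omega) hφ t hz)
    (by fun_prop : Continuous fun w : ℂ => -w / 2)
  refine (hasDerivAt_integral_of_dominated_loc_of_deriv_le hC' (Eventually.of_forall (hmeas m))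
    ((integrable_timeWeight.const_mul C).mono' (hmeas m z)
      (Eventually.of_forall hC.self_of_nhds))
    ((hmeas (m + 2) z).smul_const _) (Eventually.of_forall fun s w hw => hw s)
    (integrable_timeWeight.const_mul C')
    (Eventually.of_forall fun s w _ => ?_)).2.differentiableAt
  refine ((hasDerivAt_complexKernel m (t - s) w).mul_const _).congr_deriv ?_
  rw [smul_eq_mul]
  ring

theorem analyticAt_potential (hm : 3 ≤ m) (hφm : Measurable φ) (hφ : ∀ s, |φ s| ≤ B) (t : ℝ)
    {y : ℝ} (hy : y ≠ 0) : AnalyticAt ℝ (fun y => potential m φ (t, y)) y := by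
  have hnhds : {w : ℂ | 0 < (w ^ 2).re} ∈ 𝓝 (y : ℂ) := by
    refine (isOpen_lt continuous_const (by fun_prop)).mem_nhds ?_
    simp only [mem_ofPred_eq, ← Complex.ofReal_pow, Complex.ofReal_re]
    positivity
  have hcomplex : AnalyticAt ℂ (fun z => ∫ s, complexKernel m (t - s) z * φ s) (y : ℂ) :=
    DifferentiableOn.analyticAt (fun z hz =>
      (differentiableAt_integral_complexKernel hm hφm hφ t hz).differentiableWithinAt) hnhds
  refine hcomplex.re_ofReal.congr (Eventually.of_forall fun x => ?_)
  simp only [complexKernel_ofReal, ← Complex.ofReal_mul]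
  rw [integral_complex_ofReal, Complex.ofReal_re, potential]
  simp only [Prod.mk_sub_mk, sub_zero]

end Potential

/-! ### Bounded solutions in the half-line -/

theorem integrable_parabolicKernel_three : Integrable fun s => parabolicKernel 3 (s, 1) := by
  obtain ⟨C, -, hC⟩ := exists_parabolicKernel_le_timeWeight (m := 3) le_rfl one_pos
  refine (integrable_timeWeight.const_mul C).mono'
    ((measurable_parabolicKernel 3).comp (by fun_prop)).aestronglyMeasurable
    (Eventually.of_forall fun s => ?_)
  rw [Real.norm_of_nonneg (parabolicKernel_nonneg _ _)]
  exact hC (s, 1) (by simp [Prod.norm_def])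

theorem integral_parabolicKernel_three_pos : 0 < ∫ s, parabolicKernel 3 (s, 1) := by
  rw [integral_pos_iff_support_of_nonneg (fun s => parabolicKernel_nonneg 3 (s, 1))
    integrable_parabolicKernel_three]
  refine lt_of_lt_of_le ?_ (measure_mono (s := Ioi (0 : ℝ)) fun s hs => ?_)
  · simp
  · have : 0 < √s := Real.sqrt_pos.2 hs
    exact (by unfold parabolicKernel; positivity : 0 < parabolicKernel 3 (s, 1)).ne'

/-- The probability density of the hitting time of `0` for the Brownian motion with generator
`∂² / ∂y²` started at `y = 1`. -/
noncomputable def hittingDensity (s : ℝ) : ℝ :=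
  parabolicKernel 3 (s, 1) / ∫ r, parabolicKernel 3 (r, 1)

theorem hittingDensity_nonneg (s : ℝ) : 0 ≤ hittingDensity s :=
  div_nonneg (parabolicKernel_nonneg _ _) integral_parabolicKernel_three_pos.le

theorem hittingDensity_of_nonpos {s : ℝ} (hs : s ≤ 0) : hittingDensity s = 0 := by
  rw [hittingDensity, parabolicKernel_of_nonpos three_ne_zero hs, zero_div]

theorem integrable_hittingDensity : Integrable hittingDensity :=
  integrable_parabolicKernel_three.div_const _

theorem integral_hittingDensity : ∫ s, hittingDensity s = 1 := by
  simp only [hittingDensity]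
  rw [integral_div, div_self integral_parabolicKernel_three_pos.ne']

/-- The bounded solution `w(t, y)` of `∂ₜ w = ∂ᵧ² w` on the half-line `y ≥ 0` with boundary values
`φ`, written as an average of `φ` over hitting times; by scaling, the hitting time of `0` from `y`
is `y ^ 2` times the one from `1`. -/
noncomputable def halfLineSolution (φ : ℝ → ℝ) (t y : ℝ) : ℝ :=
  ∫ s, hittingDensity s * φ (t - y ^ 2 * s)

section HalfLineSolution

variable {φ ψ : ℝ → ℝ} {B C : ℝ}

theorem halfLineSolution_zero_right (φ : ℝ → ℝ) (t : ℝ) : halfLineSolution φ t 0 = φ t := by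
  simp [halfLineSolution, integral_mul_const, integral_hittingDensity]

theorem parabolicKernel_three_sq_mul {y : ℝ} (hy : 0 < y) (s : ℝ) :
    parabolicKernel 3 (y ^ 2 * s, y) = (y ^ 3)⁻¹ * parabolicKernel 3 (s, 1) := by
  simp only [parabolicKernel]
  rw [Real.sqrt_mul (by positivity), Real.sqrt_sq hy.le, mul_inv, mul_inv_cancel_left₀ hy.ne',
    one_mul, mul_pow, inv_pow]
  ring

theorem halfLineSolution_eq_potential (φ : ℝ → ℝ) (t : ℝ) {y : ℝ} (hy : 0 < y) :
    halfLineSolution φ t y = y / (∫ s, parabolicKernel 3 (s, 1)) * potential 3 φ (t, y) := by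
  have hconv : potential 3 φ (t, y) = ∫ τ, parabolicKernel 3 (τ, y) * φ (t - τ) := by
    rw [potential, ← integral_sub_left_eq_self (fun τ => parabolicKernel 3 (τ, y) * φ (t - τ))
      volume t]
    simp
  have hscale := Measure.integral_comp_mul_left
    (fun τ => parabolicKernel 3 (τ, y) * φ (t - τ)) (y ^ 2)
  simp only [parabolicKernel_three_sq_mul hy, mul_assoc] at hscale
  rw [← hconv, integral_const_mul, abs_of_nonneg (by positivity), smul_eq_mul] at hscale
  simp only [halfLineSolution, hittingDensity, div_mul_eq_mul_div]
  rw [integral_div]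
  congr 1
  field_simp at hscale
  linarith

theorem integrable_halfLineSolution_integrand (hφm : Measurable φ) (hφ : ∀ s, |φ s| ≤ B)
    (t y : ℝ) : Integrable fun s => hittingDensity s * φ (t - y ^ 2 * s) :=
  integrable_hittingDensity.mul_bdd (Measurable.aestronglyMeasurable (by fun_prop))
    (Eventually.of_forall fun s => hφ _)

theorem norm_halfLineSolution_integrand_le (hφ : ∀ s, |φ s| ≤ B) (t y s : ℝ) :
    ‖hittingDensity s * φ (t - y ^ 2 * s)‖ ≤ hittingDensity s * B := by
  rw [norm_mul, Real.norm_of_nonneg (hittingDensity_nonneg s)]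
  exact mul_le_mul_of_nonneg_left (hφ _) (hittingDensity_nonneg s)

theorem abs_halfLineSolution_le (hφ : ∀ s, |φ s| ≤ B) (t y : ℝ) :
    |halfLineSolution φ t y| ≤ B := by
  have h := norm_integral_le_of_norm_le (integrable_hittingDensity.mul_const B)
    (Eventually.of_forall (norm_halfLineSolution_integrand_le hφ t y))
  rwa [integral_mul_const, integral_hittingDensity, one_mul] at h

theorem continuous_halfLineSolution (hφc : Continuous φ) (hφ : ∀ s, |φ s| ≤ B) :
    Continuous fun p : ℝ × ℝ => halfLineSolution φ p.1 p.2 :=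
  continuous_of_dominated (fun p =>
    (integrable_halfLineSolution_integrand hφc.measurable hφ p.1 p.2).aestronglyMeasurable)
    (fun p => Eventually.of_forall (norm_halfLineSolution_integrand_le hφ p.1 p.2))
    (integrable_hittingDensity.mul_const B) (Eventually.of_forall fun s => by fun_prop)

theorem hasDerivAt_halfLineSolution_fst {φ' : ℝ → ℝ} (h : ∀ s, HasDerivAt φ (φ' s) s)
    (hφ'm : Measurable φ') (hφ : ∀ s, |φ s| ≤ B) (hφ' : ∀ s, |φ' s| ≤ C) (t y : ℝ) :
    HasDerivAt (fun t => halfLineSolution φ t y) (halfLineSolution φ' t y) t := by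
  have hφm : Measurable φ := (continuous_iff_continuousAt.2 fun s => (h s).continuousAt).measurable
  exact (hasDerivAt_integral_of_dominated_loc_of_deriv_le univ_mem
    (Eventually.of_forall fun t =>
      (integrable_halfLineSolution_integrand hφm hφ t y).aestronglyMeasurable)
    (integrable_halfLineSolution_integrand hφm hφ t y)
    (integrable_halfLineSolution_integrand hφ'm hφ' t y).aestronglyMeasurable
    (Eventually.of_forall fun s r _ => norm_halfLineSolution_integrand_le hφ' r y s)
    (integrable_hittingDensity.mul_const C)
    (Eventually.of_forall fun s r _ => ((h _).comp_sub_const r (y ^ 2 * s)).const_mul _)).2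

theorem halfLineSolution_add (hφm : Measurable φ) (hψm : Measurable ψ) (hφ : ∀ s, |φ s| ≤ B)
    (hψ : ∀ s, |ψ s| ≤ C) (t y : ℝ) :
    halfLineSolution (fun s => φ s + ψ s) t y
      = halfLineSolution φ t y + halfLineSolution ψ t y := by
  simp only [halfLineSolution, mul_add]
  exact integral_add (integrable_halfLineSolution_integrand hφm hφ t y)
    (integrable_halfLineSolution_integrand hψm hψ t y)

theorem halfLineSolution_congr {t : ℝ} (h : ∀ s ≤ t, φ s = ψ s) (y : ℝ) :
    halfLineSolution φ t y = halfLineSolution ψ t y := by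
  refine integral_congr_ae (Eventually.of_forall fun s => ?_)
  rcases le_total s 0 with hs | hs
  · simp only [hittingDensity_of_nonpos hs, zero_mul]
  · simp only [h (t - y ^ 2 * s) (by nlinarith [sq_nonneg y])]

end HalfLineSolution

/-! ### The boundary density -/

theorem isUnit_one_add_of_norm_sub_mul_self_lt {R : Type*} [NormedRing R] [NormOneClass R]
    [NormedAlgebra ℝ R] [CompleteSpace R] {T : R} (hT : ‖T‖ ≤ 1) (h : ‖T - T * T‖ < 2) :
    IsUnit (1 + T) := by
  -- `1 + T = 2 (1 - A)` with `A = (1 - T) / 2`, and `A * A` is a strict contraction.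
  set A : R := (1 / 2 : ℝ) • (1 - T) with hA
  have hsq : A * A = (1 / 4 : ℝ) • (1 - T - (T - T * T)) := by
    rw [hA, smul_mul_smul_comm]
    norm_num
    noncomm_ring
  have hlt : ‖A * A‖ < 1 := by
    rw [hsq, norm_smul, Real.norm_of_nonneg (by norm_num)]
    linarith [norm_sub_le (1 - T) (T - T * T), norm_sub_le 1 T, norm_one (α := R)]
  have hmul : IsUnit ((1 - A) * (1 + A)) := by
    convert isUnit_one_sub_of_norm_lt_one hlt using 1
    noncomm_ring
  have hcomm : Commute (1 - A) (1 + A) :=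
    (Commute.one_left _).sub_left ((Commute.one_right A).add_right (Commute.refl A))
  have htwo : 1 + T = (2 : ℝ) • (1 - A) := by
    have : (2 : ℝ) * (1 / 2) = 1 := by norm_num
    rw [hA, smul_sub, smul_smul, this, one_smul, two_smul]
    abel
  rw [htwo]
  exact (hcomm.isUnit_mul_iff.1 hmul).1.smul (Units.mk0 (2 : ℝ) two_ne_zero)

/-- Doeblin's minorization: the common part `R` cancels in `P - Q`. -/
theorem norm_sub_le_of_common_minorant {X : Type*} [TopologicalSpace X] [Nonempty X]
    {P Q : (X →ᵇ ℝ) →L[ℝ] (X →ᵇ ℝ)} {R : X → (X →ᵇ ℝ) →ₗ[ℝ] ℝ} {ε : ℝ} (hP : P 1 = 1)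
    (hQ : Q 1 = 1) (hR : ∀ x, R x 1 = ε) (hRP : ∀ f, 0 ≤ f → ∀ x, R x f ≤ P f x)
    (hRQ : ∀ f, 0 ≤ f → ∀ x, R x f ≤ Q f x) : ‖P - Q‖ ≤ 2 - 2 * ε := by
  have hone : (0 : X →ᵇ ℝ) ≤ 1 := fun _ => zero_le_one (α := ℝ)
  have hε : ε ≤ 1 := by
    inhabit X
    simpa [hP, hR] using hRP 1 hone default
  have hle (f : X →ᵇ ℝ) (x : X) : P f x - Q f x ≤ (2 - 2 * ε) * ‖f‖ := by
    have hbd (x : X) : |f x| ≤ ‖f‖ := f.norm_coe_le_norm x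
    have hsub := hRP (‖f‖ • 1 - f) (fun x => by simpa using (abs_le.1 (hbd x)).2) x
    have hadd := hRQ (‖f‖ • 1 + f) (fun x => by
      simpa using neg_le_iff_add_nonneg'.1 (abs_le.1 (hbd x)).1) x
    simp only [map_sub, map_add, map_smul, hP, hQ, hR, BoundedContinuousFunction.sub_apply,
      BoundedContinuousFunction.add_apply, BoundedContinuousFunction.smul_apply,
      BoundedContinuousFunction.coe_one, Pi.one_apply, smul_eq_mul] at hsub hadd
    linarith
  refine ContinuousLinearMap.opNorm_le_bound _ (by linarith) fun f => ?_
  refine (BoundedContinuousFunction.norm_le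
    (mul_nonneg (by linarith) (norm_nonneg f))).2 fun x => abs_le.2 ⟨?_, hle f x⟩
  have := hle (-f) x
  simp only [map_neg, norm_neg, BoundedContinuousFunction.neg_apply] at this
  change _ ≤ P f x - Q f x
  linarith

/-- The operator sending `φ` to the values at distance `y` from the boundary of the solution on the
half-line with boundary values `φ`. -/
noncomputable def transfer (y : ℝ) : (ℝ →ᵇ ℝ) →L[ℝ] (ℝ →ᵇ ℝ) :=
  LinearMap.mkContinuous
    { toFun f := ofNormedAddCommGroup (fun t => halfLineSolution f t y)
        ((continuous_halfLineSolution f.continuous f.norm_coe_le_norm).comp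
          (Continuous.prodMk_left y)) ‖f‖ fun t => abs_halfLineSolution_le f.norm_coe_le_norm t y
      map_add' f g := by
        ext t
        exact halfLineSolution_add f.continuous.measurable g.continuous.measurable
          f.norm_coe_le_norm g.norm_coe_le_norm t y
      map_smul' c f := by
        ext t
        simp [halfLineSolution, ← integral_const_mul, mul_left_comm] }
    1 fun f => by
      rw [one_mul]
      exact (BoundedContinuousFunction.norm_le (norm_nonneg f)).2
        fun t => abs_halfLineSolution_le f.norm_coe_le_norm t y

theorem transfer_apply (y : ℝ) (f : ℝ →ᵇ ℝ) (t : ℝ) : transfer y f t = halfLineSolution f t y := rfl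

theorem norm_transfer_le (y : ℝ) : ‖transfer y‖ ≤ 1 :=
  LinearMap.mkContinuous_norm_le _ zero_le_one _

theorem transfer_one (y : ℝ) : transfer y 1 = 1 := by
  ext t
  simp [transfer_apply, halfLineSolution, integral_hittingDensity]

theorem transfer_nonneg (y : ℝ) {f : ℝ →ᵇ ℝ} (hf : 0 ≤ f) : 0 ≤ transfer y f := fun t =>
  integral_nonneg fun s => mul_nonneg (hittingDensity_nonneg s) (hf (t - y ^ 2 * s))

theorem hittingDensity_pos {s : ℝ} (hs : 0 < s) : 0 < hittingDensity s := by
  have : 0 < √s := Real.sqrt_pos.2 hs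
  exact div_pos (by unfold parabolicKernel; positivity) integral_parabolicKernel_three_pos

theorem continuousOn_hittingDensity : ContinuousOn hittingDensity (Ioi 0) := fun s hs =>
  (((hasFDerivAt_parabolicKernel_of_pos 3 (p := (s, 1)) hs).continuousAt.comp
    (f := fun s : ℝ => (s, (1 : ℝ))) (by fun_prop)).div_const _).continuousWithinAt

/-- The integral of `f` over the time window `[t - b, t - a]`. -/
noncomputable def windowIntegral (a b t : ℝ) : (ℝ →ᵇ ℝ) →ₗ[ℝ] ℝ where
  toFun f := ∫ s in a..b, f (t - s)
  map_add' f g := intervalIntegral.integral_add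
    (Continuous.intervalIntegrable (by fun_prop) _ _)
    (Continuous.intervalIntegrable (by fun_prop) _ _)
  map_smul' c f := intervalIntegral.integral_const_mul _ _

theorem windowIntegral_apply (a b t : ℝ) (f : ℝ →ᵇ ℝ) :
    windowIntegral a b t f = ∫ s in a..b, f (t - s) := rfl

theorem windowIntegral_nonneg {a b : ℝ} (hab : a ≤ b) (t : ℝ) {f : ℝ →ᵇ ℝ} (hf : 0 ≤ f) :
    0 ≤ windowIntegral a b t f :=
  intervalIntegral.integral_nonneg hab fun s _ => hf (t - s)

theorem windowIntegral_mono {a b c d : ℝ} (hca : c ≤ a) (hab : a ≤ b) (hbd : b ≤ d) (t : ℝ)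
    {f : ℝ →ᵇ ℝ} (hf : 0 ≤ f) : windowIntegral a b t f ≤ windowIntegral c d t f :=
  intervalIntegral.integral_mono_interval hca hab hbd (Eventually.of_forall fun s => hf (t - s))
    (Continuous.intervalIntegrable (by fun_prop) _ _)

theorem windowIntegral_sub (a b t s : ℝ) (f : ℝ →ᵇ ℝ) :
    windowIntegral a b (t - s) f = windowIntegral (a + s) (b + s) t f := by
  have := intervalIntegral.integral_comp_add_right (a := a) (b := b) (fun r => f (t - r)) s
  simp only [windowIntegral_apply, ← this, sub_sub, add_comm s]

theorem exists_windowIntegral_le_transfer {y : ℝ} (hy : y ≠ 0) {a b : ℝ} (ha : 0 < a)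
    (hab : a ≤ b) :
    ∃ α > 0, ∀ f, 0 ≤ f → ∀ t, α * windowIntegral a b t f ≤ transfer y f t := by
  have hy2 : 0 < y ^ 2 := by positivity
  have hle : a / y ^ 2 ≤ b / y ^ 2 := by gcongr
  obtain ⟨s₀, hs₀, hmin⟩ := isCompact_Icc.exists_isMinOn (nonempty_Icc.2 hle)
    (continuousOn_hittingDensity.mono fun s hs => (div_pos ha hy2).trans_le hs.1)
  have hpos : 0 < hittingDensity s₀ := hittingDensity_pos ((div_pos ha hy2).trans_le hs₀.1)
  refine ⟨hittingDensity s₀ / y ^ 2, by positivity, fun f hf t => ?_⟩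
  have hint := integrable_halfLineSolution_integrand f.continuous.measurable f.norm_coe_le_norm t y
  have hcont : Continuous fun s => hittingDensity s₀ * f (t - y ^ 2 * s) := by fun_prop
  have hscale : ∫ s in (a / y ^ 2)..(b / y ^ 2), f (t - y ^ 2 * s)
      = (y ^ 2)⁻¹ * windowIntegral a b t f := by
    rw [intervalIntegral.integral_comp_mul_left (fun s => f (t - s)) hy2.ne',
      mul_div_cancel₀ _ hy2.ne', mul_div_cancel₀ _ hy2.ne', smul_eq_mul, windowIntegral_apply]
  calc hittingDensity s₀ / y ^ 2 * windowIntegral a b t f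
      = ∫ s in (a / y ^ 2)..(b / y ^ 2), hittingDensity s₀ * f (t - y ^ 2 * s) := by
        rw [intervalIntegral.integral_const_mul, hscale]; ring
    _ ≤ ∫ s in (a / y ^ 2)..(b / y ^ 2), hittingDensity s * f (t - y ^ 2 * s) :=
        intervalIntegral.integral_mono_on hle (hcont.intervalIntegrable _ _)
          hint.intervalIntegrable fun s hs => mul_le_mul_of_nonneg_right (hmin hs) (hf _)
    _ = ∫ s in Ioc (a / y ^ 2) (b / y ^ 2), hittingDensity s * f (t - y ^ 2 * s) :=
        intervalIntegral.integral_of_le hle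
    _ ≤ transfer y f t := setIntegral_le_integral hint
        (Eventually.of_forall fun s => mul_nonneg (hittingDensity_nonneg s) (hf _))

theorem exists_windowIntegral_le_transfer_mul_transfer {y : ℝ} (hy : y ≠ 0) :
    ∃ ε > 0, ∀ f, 0 ≤ f → ∀ t, ε * windowIntegral 3 4 t f ≤ transfer y f t ∧
      ε * windowIntegral 3 4 t f ≤ (transfer y * transfer y) f t := by
  obtain ⟨α, hα, h⟩ := exists_windowIntegral_le_transfer hy one_pos (b := 4) (by norm_num)
  refine ⟨min α (α ^ 2), by positivity, fun f hf t => ?_⟩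
  have h0 := windowIntegral_nonneg (show (3 : ℝ) ≤ 4 by norm_num) t hf
  refine ⟨?_, ?_⟩
  · calc _ ≤ α * windowIntegral 3 4 t f := by gcongr; exact min_le_left _ _
      _ ≤ α * windowIntegral 1 4 t f := by
          gcongr; exact windowIntegral_mono (by norm_num) (by norm_num) le_rfl t hf
      _ ≤ transfer y f t := h f hf t
  · have hshift : ∀ s ∈ Icc (1 : ℝ) 2, α * windowIntegral 3 4 t f ≤ transfer y f (t - s) := by
      intro s hs
      refine le_trans ?_ (h f hf (t - s))
      rw [windowIntegral_sub]
      gcongr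
      exact windowIntegral_mono (by linarith [hs.2]) (by norm_num) (by linarith [hs.1]) t hf
    calc _ ≤ α ^ 2 * windowIntegral 3 4 t f := by gcongr; exact min_le_right _ _
      _ = α * ∫ _ in (1 : ℝ)..2, α * windowIntegral 3 4 t f := by
          rw [intervalIntegral.integral_const, smul_eq_mul]; ring
      _ ≤ α * windowIntegral 1 2 t (transfer y f) := by
          gcongr
          exact intervalIntegral.integral_mono_on (by norm_num) (by simp)
            (Continuous.intervalIntegrable (by fun_prop) _ _) hshift
      _ ≤ α * windowIntegral 1 4 t (transfer y f) := by
          gcongr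
          exact windowIntegral_mono le_rfl (by norm_num) (by norm_num) t (transfer_nonneg y hf)
      _ ≤ transfer y (transfer y f) t := h _ (transfer_nonneg y hf) t

theorem isUnit_one_add_transfer {y : ℝ} (hy : y ≠ 0) : IsUnit (1 + transfer y) := by
  obtain ⟨ε, hε, h⟩ := exists_windowIntegral_le_transfer_mul_transfer hy
  have : Nontrivial (ℝ →ᵇ ℝ) := NormOneClass.nontrivial
  refine isUnit_one_add_of_norm_sub_mul_self_lt (R := (ℝ →ᵇ ℝ) →L[ℝ] (ℝ →ᵇ ℝ))
    (norm_transfer_le y) ?_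
  have hmass (t : ℝ) : (ε • windowIntegral 3 4 t) 1 = ε := by
    simp only [LinearMap.smul_apply, windowIntegral_apply, BoundedContinuousFunction.coe_one,
      Pi.one_apply, intervalIntegral.integral_const, smul_eq_mul]
    norm_num
  have := norm_sub_le_of_common_minorant (P := transfer y) (Q := transfer y * transfer y)
    (transfer_one y) (by simp [transfer_one]) hmass
    (fun f hf t => (h f hf t).1) (fun f hf t => (h f hf t).2)
  linarith

theorem exists_add_halfLineSolution_eq {y : ℝ} (hy : y ≠ 0) {g : ℝ → ℝ} (hg : Continuous g) {B : ℝ}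
    (hB : ∀ t, |g t| ≤ B) :
    ∃ φ : ℝ → ℝ, Continuous φ ∧ (∃ C, ∀ t, |φ t| ≤ C) ∧
      ∀ t, φ t + halfLineSolution φ t y = g t := by
  obtain ⟨V, hV⟩ := (isUnit_one_add_transfer hy).exists_right_inv
  set φ := V (ofNormedAddCommGroup g hg B hB)
  have hφ : φ + transfer y φ = ofNormedAddCommGroup g hg B hB := DFunLike.congr_fun hV _
  exact ⟨φ, φ.continuous, ⟨‖φ‖, φ.norm_coe_le_norm⟩, fun t => DFunLike.congr_fun hφ t⟩

/-! ### Curves in spaces of continuous functions -/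

theorem hasDerivWithinAt_of_forall_apply {X : Type*} [TopologicalSpace X] [CompactSpace X]
    {I : Set ℝ} (hI : Convex ℝ I) {W V : ℝ → C(X, ℝ)} (hV : ContinuousOn V I)
    (h : ∀ t ∈ I, ∀ x, HasDerivWithinAt (fun s => W s x) (V t x) I t) {t : ℝ} (ht : t ∈ I) :
    HasDerivWithinAt W (V t) I t := by
  rw [hasDerivWithinAt_iff_isLittleO, Asymptotics.isLittleO_iff]
  intro ε hε
  obtain ⟨δ, hδ, hball⟩ := Metric.mem_nhdsWithin_iff.1
    ((hV t ht).eventually (Metric.closedBall_mem_nhds (V t) hε))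
  filter_upwards [inter_mem_nhdsWithin I (Metric.ball_mem_nhds t hδ)] with s hs
  refine (ContinuousMap.norm_le _ (by positivity)).2 fun x => ?_
  have hmvt := ((convex_ball t δ).inter hI).norm_image_sub_le_of_norm_hasDerivWithin_le
    (f := fun r => W r x - r * V t x) (f' := fun r => V r x - V t x) (C := ε)
    (fun r hr => ?_) (fun r hr => ?_) ⟨Metric.mem_ball_self hδ, ht⟩ hs.symm
  · refine le_of_eq_of_le ?_ hmvt
    simp only [ContinuousMap.sub_apply, ContinuousMap.smul_apply, smul_eq_mul]
    ring_nf
  · have hsub := (h r hr.2 x).sub ((hasDerivWithinAt_id r I).mul_const (V t x))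
    rw [one_mul] at hsub
    exact hsub.mono inter_subset_right
  · exact ((V r - V t).norm_coe_le_norm x).trans (by simpa [dist_eq_norm] using hball hr)

/-- The curve `t ↦ w t` in the space of continuous functions on `K`, with the value `0` at those `t`
for which `w t` is not continuous on `K`. -/
noncomputable def slice (K : Set ℝ) (w : ℝ → ℝ → ℝ) (t : ℝ) : C(K, ℝ) :=
  ContinuousMap.mkD (K.domRestrict (w t)) 0

theorem slice_apply {K : Set ℝ} {w : ℝ → ℝ → ℝ} {t : ℝ} (h : ContinuousOn (w t) K) (x : K) :
    slice K w t x = w t x :=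
  ContinuousMap.mkD_apply_of_continuousOn h

section Slice

variable {I K : Set ℝ} {w w' : ℝ → ℝ → ℝ}

theorem continuousOn_slice (h : ContinuousOn (fun p : ℝ × ℝ => w p.1 p.2) (I ×ˢ K)) :
    ContinuousOn (slice K w) I :=
  ContinuousMap.continuousOn_mkD_restrict_of_uncurry w 0 h

theorem continuousOn_of_mem_of_continuousOn_prod
    (h : ContinuousOn (fun p : ℝ × ℝ => w p.1 p.2) (I ×ˢ K)) {t : ℝ} (ht : t ∈ I) :
    ContinuousOn (w t) K :=
  h.comp (Continuous.prodMk_right t).continuousOn fun _ hx => ⟨ht, hx⟩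

theorem hasDerivWithinAt_slice [CompactSpace K] (hI : Convex ℝ I)
    (hw : ContinuousOn (fun p : ℝ × ℝ => w p.1 p.2) (I ×ˢ K))
    (hw' : ContinuousOn (fun p : ℝ × ℝ => w' p.1 p.2) (I ×ˢ K))
    (hd : ∀ t ∈ I, ∀ x ∈ K, HasDerivAt (fun s => w s x) (w' t x) t) {t : ℝ} (ht : t ∈ I) :
    HasDerivWithinAt (slice K w) (slice K w' t) I t := by
  refine hasDerivWithinAt_of_forall_apply hI (continuousOn_slice hw') (fun t ht x => ?_) ht
  rw [slice_apply (continuousOn_of_mem_of_continuousOn_prod hw' ht)]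
  exact (hd t ht x x.2).hasDerivWithinAt.congr
    (fun s hs => slice_apply (continuousOn_of_mem_of_continuousOn_prod hw hs) x)
    (slice_apply (continuousOn_of_mem_of_continuousOn_prod hw ht) x)

theorem contDiffOn_succ_slice [CompactSpace K] (hI : Convex ℝ I) (hu : UniqueDiffOn ℝ I) {n : ℕ}
    (hw : ContinuousOn (fun p : ℝ × ℝ => w p.1 p.2) (I ×ˢ K))
    (hw' : ContinuousOn (fun p : ℝ × ℝ => w' p.1 p.2) (I ×ˢ K))
    (hd : ∀ t ∈ I, ∀ x ∈ K, HasDerivAt (fun s => w s x) (w' t x) t)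
    (h : ContDiffOn ℝ n (slice K w') I) : ContDiffOn ℝ (n + 1 : ℕ) (slice K w) I := by
  have hderiv (t : ℝ) (ht : t ∈ I) := hasDerivWithinAt_slice hI hw hw' hd ht
  push_cast
  exact (contDiffOn_succ_iff_derivWithin hu).2 ⟨fun t ht => (hderiv t ht).differentiableWithinAt,
    fun hn => absurd hn (WithTop.natCast_ne_top n),
    h.congr fun t ht => (hderiv t ht).derivWithin (hu t ht)⟩

theorem contDiffOn_slice [CompactSpace K] (hI : Convex ℝ I) (hu : UniqueDiffOn ℝ I)
    {Ω : Set (ℝ × ℝ)} (hΩ : IsOpen Ω) (hsub : I ×ˢ K ⊆ Ω) {n : ℕ}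
    (h : ContDiffOn ℝ n (fun p : ℝ × ℝ => w p.1 p.2) Ω) : ContDiffOn ℝ n (slice K w) I := by
  induction n generalizing w with
  | zero => exact contDiffOn_zero.2 (continuousOn_slice (h.continuousOn.mono hsub))
  | succ n ih =>
    push_cast at h
    obtain ⟨hdiff, -, hfderiv⟩ := (contDiffOn_succ_iff_fderiv_of_isOpen hΩ).1 h
    have hw' : ContDiffOn ℝ n (fun p => fderiv ℝ (fun q : ℝ × ℝ => w q.1 q.2) p (1, 0)) Ω :=
      hfderiv.clm_apply contDiffOn_const
    refine contDiffOn_succ_slice hI hu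
      (w' := fun t x => fderiv ℝ (fun q : ℝ × ℝ => w q.1 q.2) (t, x) (1, 0))
      (h.continuousOn.mono hsub) (hw'.continuousOn.mono hsub) (fun t ht x hx => ?_) (ih hw')
    have hmem : (t, x) ∈ Ω := hsub ⟨ht, hx⟩
    exact (hdiff.differentiableAt (hΩ.mem_nhds hmem)).hasFDerivAt.comp_hasDerivAt t
      ((hasDerivAt_id t).prodMk (hasDerivAt_const t x))

end Slice

/-! ### Membership in `C¹((-∞, 0], C²([0, r]))` -/

theorem contDiffOn_two_of_hasDerivWithinAt {f f₁ f₂ : ℝ → ℝ} {s : Set ℝ} (hs : UniqueDiffOn ℝ s)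
    (h₁ : ∀ x ∈ s, HasDerivWithinAt f (f₁ x) s x) (h₂ : ∀ x ∈ s, HasDerivWithinAt f₁ (f₂ x) s x)
    (hc : ContinuousOn f₂ s) :
    ContDiffOn ℝ 2 f s ∧ EqOn (iteratedDerivWithin 1 f s) f₁ s ∧
      EqOn (iteratedDerivWithin 2 f s) f₂ s := by
  have e₁ : EqOn (derivWithin f s) f₁ s := fun x hx => (h₁ x hx).derivWithin (hs x hx)
  have e₂ : EqOn (derivWithin f₁ s) f₂ s := fun x hx => (h₂ x hx).derivWithin (hs x hx)
  have hf₁ : ContDiffOn ℝ (0 + 1) f₁ s := (contDiffOn_succ_iff_derivWithin hs).2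
    ⟨fun x hx => (h₂ x hx).differentiableWithinAt, by simp, contDiffOn_zero.2 (hc.congr e₂)⟩
  rw [zero_add] at hf₁
  refine ⟨?_, fun x hx => by rw [iteratedDerivWithin_one, e₁ hx], fun x hx => ?_⟩
  · rw [← one_add_one_eq_two]
    exact (contDiffOn_succ_iff_derivWithin hs).2
      ⟨fun x hx => (h₁ x hx).differentiableWithinAt, by simp, hf₁.congr e₁⟩
  · rw [iteratedDerivWithin_succ, ← e₂ hx]
    exact derivWithin_congr (fun z hz => by rw [iteratedDerivWithin_one, e₁ hz])
      (by rw [iteratedDerivWithin_one, e₁ hx])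

/-- The primitive vanishing at `0`, as an operator on the continuous functions on `[0, r]`. -/
noncomputable def primitive {r : ℝ} (hr : 0 ≤ r) : C(Icc (0 : ℝ) r, ℝ) →L[ℝ] C(Icc (0 : ℝ) r, ℝ) :=
  LinearMap.mkContinuous
    { toFun f := ⟨fun x => ∫ z in (0 : ℝ)..x, IccExtend hr f z,
        (intervalIntegral.continuous_primitive (fun a b =>
          (f.continuous.Icc_extend' (h := hr)).intervalIntegrable a b) 0).comp
          continuous_subtype_val⟩
      map_add' f g := by
        ext x
        exact intervalIntegral.integral_add
          ((f.continuous.Icc_extend' (h := hr)).intervalIntegrable _ _)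
          ((g.continuous.Icc_extend' (h := hr)).intervalIntegrable _ _)
      map_smul' c f := by
        ext x
        exact intervalIntegral.integral_const_mul c _ }
    r fun f => by
      refine (ContinuousMap.norm_le _ (by positivity)).2 fun x => ?_
      have h := intervalIntegral.norm_integral_le_of_norm_le_const (a := 0) (b := x)
        (f := IccExtend hr f) (C := ‖f‖) fun z _ => f.norm_coe_le_norm _
      rw [sub_zero, abs_of_nonneg x.2.1, mul_comm] at h
      exact h.trans (mul_le_mul_of_nonneg_right x.2.2 (norm_nonneg f))

theorem primitive_apply {r : ℝ} (hr : 0 ≤ r) (f : C(Icc (0 : ℝ) r, ℝ)) (x : Icc (0 : ℝ) r) :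
    primitive hr f x = ∫ z in (0 : ℝ)..x, IccExtend hr f z := rfl

/-- The content is at the end point `x = r`, where no derivative of `f` is assumed. -/
theorem hasDerivWithinAt_integral_of_hasDerivAt_Ico {f f₁ f₂ : ℝ → ℝ} {r : ℝ}
    (hf : ContinuousOn f (Icc 0 r)) (hf₂ : Continuous f₂)
    (h₁ : ∀ x ∈ Ico 0 r, HasDerivAt f (f₁ x) x) (h₂ : ∀ x ∈ Ico 0 r, HasDerivAt f₁ (f₂ x) x)
    (h0 : f₁ 0 = 0) {x : ℝ} (hx : x ∈ Icc 0 r) :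
    HasDerivWithinAt f (∫ z in (0 : ℝ)..x, f₂ z) (Icc 0 r) x := by
  have hf₁ : ∀ y ∈ Ico 0 r, f₁ y = ∫ z in (0 : ℝ)..y, f₂ z := fun y hy => by
    have hmem : ∀ z ∈ Icc 0 y, z ∈ Ico 0 r := fun z hz => ⟨hz.1, hz.2.trans_lt hy.2⟩
    rw [intervalIntegral.integral_eq_sub_of_hasDerivAt_of_le hy.1
      (fun z hz => (h₂ z (hmem z hz)).continuousAt.continuousWithinAt)
      (fun z hz => h₂ z (hmem z (Ioo_subset_Icc_self hz))) (hf₂.intervalIntegrable _ _), h0,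
      sub_zero]
  have hcont : Continuous fun y => ∫ z in (0 : ℝ)..y, f₂ z :=
    intervalIntegral.continuous_primitive (fun a b => hf₂.intervalIntegrable a b) 0
  have hf_eq : ∀ y ∈ Icc 0 r, f y = f 0 + ∫ z in (0 : ℝ)..y, ∫ s in (0 : ℝ)..z, f₂ s := by
    intro y hy
    rw [intervalIntegral.integral_eq_sub_of_hasDerivAt_of_le hy.1
      (hf.mono (Icc_subset_Icc_right hy.2)) (fun z hz => ?_) (hcont.intervalIntegrable _ _)]
    · ring
    · have hz' : z ∈ Ico 0 r := ⟨hz.1.le, hz.2.trans_le hy.2⟩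
      exact hf₁ z hz' ▸ h₁ z hz'
  exact ((hcont.integral_hasStrictDerivAt 0 x).hasDerivAt.const_add (f 0)).hasDerivWithinAt.congr
    hf_eq (hf_eq x hx)

theorem memC1C2_of_curves {w f₁ : ℝ → ℝ → ℝ} {r : ℝ} (hr : 0 < r)
    {V₀ V₂ : ℝ → C(Icc (0 : ℝ) r, ℝ)} (hV₀ : ContDiffOn ℝ 1 V₀ (Iic 0))
    (hV₂ : ContDiffOn ℝ 1 V₂ (Iic 0)) (hw : ∀ t ≤ 0, ∀ x, V₀ t x = w t x)
    (h₁ : ∀ t ≤ 0, ∀ x ∈ Ico 0 r, HasDerivAt (w t) (f₁ t x) x)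
    (h₂ : ∀ t ≤ 0, ∀ x ∈ Ico 0 r, HasDerivAt (f₁ t) (IccExtend hr.le (V₂ t) x) x)
    (h0 : ∀ t ≤ 0, f₁ t 0 = 0) : MemC1C2 w r := by
  have hcont (t : ℝ) : Continuous (IccExtend hr.le (V₂ t)) := (V₂ t).continuous.Icc_extend'
  have key (t : ℝ) (ht : t ≤ 0) := contDiffOn_two_of_hasDerivWithinAt (uniqueDiffOn_Icc hr)
    (fun x hx => hasDerivWithinAt_integral_of_hasDerivAt_Ico
      (continuousOn_iff_continuous_domRestrict.2 ((V₀ t).continuous.congr (hw t ht))) (hcont t)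
      (h₁ t ht) (h₂ t ht) (h0 t ht) hx)
    (fun x _ => ((hcont t).integral_hasStrictDerivAt 0 x).hasDerivAt.hasDerivWithinAt)
    (hcont t).continuousOn
  refine ⟨fun t ht => (key t ht).1, fun j hj => ?_⟩
  interval_cases j
  · exact ⟨V₀, hV₀, fun t ht x => by rw [hw t ht, iteratedDerivWithin_zero]⟩
  · exact ⟨fun t => primitive hr.le (V₂ t), (primitive hr.le).contDiff.comp_contDiffOn hV₂,
      fun t ht x => by rw [(key t ht).2.1 x.2, primitive_apply]⟩
  · exact ⟨V₂, hV₂, fun t ht x => by rw [(key t ht).2.2 x.2, IccExtend_val]⟩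

theorem MemC1C2.const_mul {w : ℝ → ℝ → ℝ} {r : ℝ} (h : MemC1C2 w r) (hr : 0 < r) {c : ℝ → ℝ}
    (hc : ContDiffOn ℝ 1 c (Iic 0)) : MemC1C2 (fun t x => c t * w t x) r := by
  refine ⟨fun t ht => contDiffOn_const.mul (h.1 t ht), fun j hj => ?_⟩
  obtain ⟨W, hW, hWw⟩ := h.2 j hj
  refine ⟨fun t => c t • W t, hc.smul hW, fun t ht x => ?_⟩
  rw [iteratedDerivWithin_const_mul x.2 (uniqueDiffOn_Icc hr) (c t)
    (((h.1 t ht).of_le (mod_cast hj)) x x.2), ← hWw t ht x, ContinuousMap.smul_apply, smul_eq_mul]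

/-! ### Bounded solutions in the strip `-1 < x < 1` -/

section Derivatives

variable {φ : ℝ → ℝ} {B : ℝ} {m : ℕ}

theorem hasDerivAt_potential_fst (hm : 3 ≤ m) (hφm : Measurable φ) (hφ : ∀ s, |φ s| ≤ B) (t : ℝ)
    {y : ℝ} (hy : y ≠ 0) :
    HasDerivAt (fun t => potential m φ (t, y))
      (-(m / 2) * potential (m + 2) φ (t, y) + y ^ 2 / 4 * potential (m + 4) φ (t, y)) t := by
  have h := (hasFDerivAt_potential hm hφm hφ (p := (t, y)) fun hp => hy hp.2).comp_hasDerivAt t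
    ((hasDerivAt_id t).prodMk (hasDerivAt_const t y))
  exact h.congr_deriv (by simp [fderivCoeffTwo, fderivCoeffFour]; ring)

theorem hasDerivAt_potential_snd (hm : 3 ≤ m) (hφm : Measurable φ) (hφ : ∀ s, |φ s| ≤ B) (t : ℝ)
    {y : ℝ} (hy : y ≠ 0) :
    HasDerivAt (fun y => potential m φ (t, y)) (-(y / 2) * potential (m + 2) φ (t, y)) y := by
  have h := (hasFDerivAt_potential hm hφm hφ (p := (t, y)) fun hp => hy hp.2).comp_hasDerivAt y
    ((hasDerivAt_const y t).prodMk (hasDerivAt_id y))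
  exact h.congr_deriv (by simp [fderivCoeffTwo, fderivCoeffFour]; ring)

/-- The space derivative `∂ᵧ` of `halfLineSolution φ`. -/
noncomputable def halfLineFlux (φ : ℝ → ℝ) (t y : ℝ) : ℝ :=
  (potential 3 φ (t, y) - y ^ 2 / 2 * potential 5 φ (t, y)) / ∫ s, parabolicKernel 3 (s, 1)

/-- The common value of `∂ₜ` and `∂ᵧ²` on `halfLineSolution φ`. -/
noncomputable def halfLineRate (φ : ℝ → ℝ) (t y : ℝ) : ℝ :=
  (-(3 / 2) * y * potential 5 φ (t, y) + y ^ 3 / 4 * potential 7 φ (t, y))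
    / ∫ s, parabolicKernel 3 (s, 1)

theorem hasDerivAt_halfLineSolution_halfLineRate (hφm : Measurable φ) (hφ : ∀ s, |φ s| ≤ B) (t : ℝ)
    {y : ℝ} (hy : 0 < y) :
    HasDerivAt (fun t => halfLineSolution φ t y) (halfLineRate φ t y) t := by
  simp only [halfLineSolution_eq_potential φ _ hy]
  refine ((hasDerivAt_potential_fst le_rfl hφm hφ t hy.ne').const_mul _).congr_deriv ?_
  rw [halfLineRate]
  push_cast
  ring

theorem hasDerivAt_halfLineSolution_snd (hφm : Measurable φ) (hφ : ∀ s, |φ s| ≤ B) (t : ℝ) {y : ℝ}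
    (hy : 0 < y) : HasDerivAt (halfLineSolution φ t) (halfLineFlux φ t y) y := by
  have h := ((hasDerivAt_id y).div_const (∫ s, parabolicKernel 3 (s, 1))).mul
    (hasDerivAt_potential_snd le_rfl hφm hφ t hy.ne')
  refine (h.congr_deriv ?_).congr_of_eventuallyEq ?_
  · simp only [halfLineFlux, id]
    ring
  · filter_upwards [lt_mem_nhds hy] with z hz using halfLineSolution_eq_potential φ t hz

theorem hasDerivAt_halfLineFlux (hφm : Measurable φ) (hφ : ∀ s, |φ s| ≤ B) (t : ℝ) {y : ℝ}
    (hy : 0 < y) : HasDerivAt (halfLineFlux φ t) (halfLineRate φ t y) y := by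
  have h := ((hasDerivAt_potential_snd le_rfl hφm hφ t hy.ne').sub
    ((((hasDerivAt_id y).pow 2).div_const 2).mul
      (hasDerivAt_potential_snd (m := 5) (by norm_num) hφm hφ t hy.ne'))).div_const
        (∫ s, parabolicKernel 3 (s, 1))
  refine h.congr_deriv ?_
  simp only [halfLineRate, Pi.pow_apply, id]
  push_cast
  ring

theorem contDiffOn_halfLineSolution (hφm : Measurable φ) (hφ : ∀ s, |φ s| ≤ B) :
    ContDiffOn ℝ ∞ (fun p : ℝ × ℝ => halfLineSolution φ p.1 p.2) {p | 0 < p.2} := by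
  have hpot : ContDiffOn ℝ ∞ (potential 3 φ) {p | 0 < p.2} :=
    (contDiffOn_potential le_rfl hφm hφ).mono fun p hp h => (show 0 < p.2 from hp).ne' h.2
  exact ((contDiff_snd.div_const (∫ s, parabolicKernel 3 (s, 1))).contDiffOn.mul hpot).congr
    fun p hp => halfLineSolution_eq_potential φ p.1 hp

theorem analyticAt_halfLineSolution (hφm : Measurable φ) (hφ : ∀ s, |φ s| ≤ B) (t : ℝ) {y : ℝ}
    (hy : 0 < y) : AnalyticAt ℝ (halfLineSolution φ t) y := by
  refine ((analyticAt_id.div_const (c := ∫ s, parabolicKernel 3 (s, 1))).mul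
    (analyticAt_potential le_rfl hφm hφ t hy.ne')).congr ?_
  filter_upwards [lt_mem_nhds hy] with z hz using (halfLineSolution_eq_potential φ t hz).symm

end Derivatives

/-- The solution of `∂ₜ w = ∂ₓ² w` in the strip `-1 < x < 1`, even in `x`, that is the sum of the
half-line solutions with boundary values `φ` issuing from `x = 1` and from `x = -1`. -/
noncomputable def stripSolution (φ : ℝ → ℝ) (t x : ℝ) : ℝ :=
  halfLineSolution φ t (1 - x) + halfLineSolution φ t (1 + x)

/-- The space derivative `∂ₓ` of `stripSolution φ`. -/
noncomputable def stripFlux (φ : ℝ → ℝ) (t x : ℝ) : ℝ :=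
  -halfLineFlux φ t (1 - x) + halfLineFlux φ t (1 + x)

/-- The common value of `∂ₜ` and `∂ₓ²` on `stripSolution φ`. -/
noncomputable def stripRate (φ : ℝ → ℝ) (t x : ℝ) : ℝ :=
  halfLineRate φ t (1 - x) + halfLineRate φ t (1 + x)

section StripSolution

variable {φ : ℝ → ℝ} {B : ℝ}

theorem stripSolution_neg (φ : ℝ → ℝ) (t x : ℝ) : stripSolution φ t (-x) = stripSolution φ t x := by
  rw [stripSolution, sub_neg_eq_add, ← sub_eq_add_neg, add_comm, stripSolution]

theorem stripSolution_one (φ : ℝ → ℝ) (t : ℝ) :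
    stripSolution φ t 1 = φ t + halfLineSolution φ t 2 := by
  rw [stripSolution, sub_self, halfLineSolution_zero_right, one_add_one_eq_two]

theorem stripFlux_zero_right (φ : ℝ → ℝ) (t : ℝ) : stripFlux φ t 0 = 0 := by simp [stripFlux]

theorem abs_stripSolution_le (hφ : ∀ s, |φ s| ≤ B) (t x : ℝ) : |stripSolution φ t x| ≤ 2 * B := by
  rw [two_mul]
  exact (abs_add_le _ _).trans
    (add_le_add (abs_halfLineSolution_le hφ t _) (abs_halfLineSolution_le hφ t _))

theorem continuous_stripSolution (hφc : Continuous φ) (hφ : ∀ s, |φ s| ≤ B) :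
    Continuous fun p : ℝ × ℝ => stripSolution φ p.1 p.2 := by
  have h := continuous_halfLineSolution hφc hφ
  exact (h.comp (by fun_prop : Continuous fun p : ℝ × ℝ => (p.1, 1 - p.2))).add
    (h.comp (by fun_prop : Continuous fun p : ℝ × ℝ => (p.1, 1 + p.2)))

theorem contDiffOn_stripSolution (hφm : Measurable φ) (hφ : ∀ s, |φ s| ≤ B) :
    ContDiffOn ℝ ∞ (fun p : ℝ × ℝ => stripSolution φ p.1 p.2) (univ ×ˢ Ioo (-1) 1) := by
  have h := contDiffOn_halfLineSolution hφm hφ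
  exact (h.comp (f := fun p : ℝ × ℝ => (p.1, 1 - p.2)) (by fun_prop)
    fun p hp => sub_pos.2 hp.2.2).add
      (h.comp (f := fun p : ℝ × ℝ => (p.1, 1 + p.2)) (by fun_prop)
        fun p hp => neg_lt_iff_pos_add'.1 hp.2.1)

theorem hasDerivAt_stripSolution_fst (hφm : Measurable φ) (hφ : ∀ s, |φ s| ≤ B) (t : ℝ) {x : ℝ}
    (hx : x ∈ Ioo (-1) 1) : HasDerivAt (fun t => stripSolution φ t x) (stripRate φ t x) t :=
  (hasDerivAt_halfLineSolution_halfLineRate hφm hφ t (by linarith [hx.2])).add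
    (hasDerivAt_halfLineSolution_halfLineRate hφm hφ t (by linarith [hx.1]))

theorem hasDerivAt_stripSolution_snd (hφm : Measurable φ) (hφ : ∀ s, |φ s| ≤ B) (t : ℝ) {x : ℝ}
    (hx : x ∈ Ioo (-1) 1) : HasDerivAt (stripSolution φ t) (stripFlux φ t x) x :=
  ((hasDerivAt_halfLineSolution_snd hφm hφ t (by linarith [hx.2])).comp_const_sub 1 x).add
    ((hasDerivAt_halfLineSolution_snd hφm hφ t (by linarith [hx.1])).comp_const_add 1 x)

theorem hasDerivAt_stripFlux (hφm : Measurable φ) (hφ : ∀ s, |φ s| ≤ B) (t : ℝ) {x : ℝ}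
    (hx : x ∈ Ioo (-1) 1) : HasDerivAt (stripFlux φ t) (stripRate φ t x) x := by
  have h := ((hasDerivAt_halfLineFlux hφm hφ t (by linarith [hx.2])).comp_const_sub 1 x).neg.add
    ((hasDerivAt_halfLineFlux hφm hφ t (by linarith [hx.1])).comp_const_add 1 x)
  exact h.congr_deriv (by rw [neg_neg, stripRate])

theorem analyticAt_stripSolution (hφm : Measurable φ) (hφ : ∀ s, |φ s| ≤ B) (t : ℝ) {x : ℝ}
    (hx : x ∈ Ioo (-1) 1) : AnalyticAt ℝ (stripSolution φ t) x :=
  ((analyticAt_halfLineSolution hφm hφ t (y := 1 - x) (by linarith [hx.2])).fun_comp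
    (f := fun x : ℝ => 1 - x) (by fun_prop)).add
      ((analyticAt_halfLineSolution hφm hφ t (y := 1 + x) (by linarith [hx.1])).fun_comp
        (f := fun x : ℝ => 1 + x) (by fun_prop))

/-- By the heat equation `∂ₓ²` of the solution is `∂ₜ` of it, so two time derivatives of the curve
of its slices are all that is needed. -/
theorem memC1C2_stripSolution (hφc : Continuous φ) (hφ : ∀ s, |φ s| ≤ B) {r : ℝ} (hr : 0 < r)
    (hr1 : r ≤ 1) (h : ContDiffOn ℝ 2 (slice (Icc 0 r) (stripSolution φ)) (Iic 0)) :
    MemC1C2 (stripSolution φ) r := by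
  set V := slice (Icc 0 r) (stripSolution φ)
  have hV (t : ℝ) (x : Icc 0 r) : V t x = stripSolution φ t x :=
    slice_apply ((continuous_stripSolution hφc hφ).comp (.prodMk_right t)).continuousOn x
  have hmem {x : ℝ} (hx : x ∈ Ico 0 r) : x ∈ Ioo (-1 : ℝ) 1 :=
    ⟨by linarith [hx.1], hx.2.trans_le hr1⟩
  rw [← one_add_one_eq_two] at h
  obtain ⟨hVd, -, hV'⟩ := (contDiffOn_succ_iff_derivWithin (uniqueDiffOn_Iic 0)).1 h
  have hrate (t : ℝ) (ht : t ≤ 0) (x : ℝ) (hx : x ∈ Ico 0 r) :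
      IccExtend hr.le ⇑(derivWithin V (Iic 0) t) x = stripRate φ t x := by
    have hx' := Ico_subset_Icc_self hx
    have heval := (ContinuousMap.evalCLM ℝ (⟨x, hx'⟩ : Icc 0 r)).hasFDerivAt.comp_hasDerivWithinAt
      t (hVd t ht).hasDerivWithinAt
    have hstrip := (hasDerivAt_stripSolution_fst hφc.measurable hφ t (hmem hx)).hasDerivWithinAt
      (s := Iic 0)
    rw [IccExtend_of_mem _ _ hx']
    exact (uniqueDiffOn_Iic 0 t ht).eq_deriv _ heval
      (hstrip.congr_of_mem (fun s _ => hV s ⟨x, hx'⟩) ht)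
  refine memC1C2_of_curves hr (h.of_le le_self_add) hV' (fun t _ => hV t)
    (fun t _ x hx => hasDerivAt_stripSolution_snd hφc.measurable hφ t (hmem hx))
    (fun t ht x hx => ?_) (fun t _ => stripFlux_zero_right φ t)
  rw [hrate t ht x hx]
  exact hasDerivAt_stripFlux hφc.measurable hφ t (hmem hx)

end StripSolution

/-! ### The damped solution -/

/-- The solution `e^(-γ t) w(t, x)` of `∂ₜ v = ∂ₓ² v - γ v`, where `w` is `stripSolution φ`. -/
noncomputable def dampedSolution (γ : ℝ) (φ : ℝ → ℝ) (t x : ℝ) : ℝ :=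
  Real.exp (-γ * t) * stripSolution φ t x

section DampedSolution

variable {φ : ℝ → ℝ} {B : ℝ}

theorem memC1C2_dampedSolution (γ : ℝ) (hφc : Continuous φ) (hφ : ∀ s, |φ s| ≤ B) {r : ℝ}
    (hr : 0 < r) (hr1 : r ≤ 1)
    (h : ContDiffOn ℝ 2 (slice (Icc 0 r) (stripSolution φ)) (Iic 0)) :
    MemC1C2 (dampedSolution γ φ) r :=
  (memC1C2_stripSolution hφc hφ hr hr1 h).const_mul hr (by fun_prop)

theorem abs_dampedSolution_le (γ : ℝ) (hφ : ∀ s, |φ s| ≤ B) (t x : ℝ) :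
    |dampedSolution γ φ t x| ≤ 2 * B * Real.exp (-γ * t) := by
  rw [dampedSolution, abs_mul, Real.abs_exp, mul_comm]
  exact mul_le_mul_of_nonneg_right (abs_stripSolution_le hφ t x) (Real.exp_pos _).le

theorem continuous_dampedSolution (γ : ℝ) (hφc : Continuous φ) (hφ : ∀ s, |φ s| ≤ B) :
    Continuous fun p : ℝ × ℝ => dampedSolution γ φ p.1 p.2 :=
  (by fun_prop : Continuous fun p : ℝ × ℝ => Real.exp (-γ * p.1)).mul
    (continuous_stripSolution hφc hφ)

theorem iteratedDerivWithin_odd_eq_zero {f : ℝ → ℝ} (hf : ∀ x, f (-x) = f x) {s : Set ℝ}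
    (hs : UniqueDiffOn ℝ s) (h0 : 0 ∈ s) {k : ℕ} (hk : Odd k) (hd : ContDiffAt ℝ k f 0) :
    iteratedDerivWithin k f s 0 = 0 := by
  rw [iteratedDerivWithin_eq_iteratedDeriv hs hd h0]
  have h := iteratedDeriv_comp_neg k f 0
  simp only [hf, neg_zero, hk.neg_one_pow, smul_eq_mul] at h
  linarith

theorem dampedSolution_mem_spaceA (γ : ℝ) (hφc : Continuous φ) (hφ : ∀ s, |φ s| ≤ B) (t : ℝ) :
    dampedSolution γ φ t ∈ spaceA := by
  have ha (x : ℝ) (hx : x ∈ Ioo (-1) 1) : AnalyticAt ℝ (dampedSolution γ φ t) x :=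
    analyticAt_const.mul (analyticAt_stripSolution hφc.measurable hφ t hx)
  refine ⟨?_, fun x hx => (ha x ⟨by linarith [hx.1], hx.2⟩).analyticWithinAt, fun k => ?_⟩
  · have hc := (continuous_dampedSolution γ hφc hφ).comp (.prodMk_right t)
    exact MemLp.of_bound hc.aestronglyMeasurable _
      (Eventually.of_forall (abs_dampedSolution_le γ hφ t))
  · exact iteratedDerivWithin_odd_eq_zero
      (fun x => by rw [dampedSolution, stripSolution_neg, dampedSolution])
      (uniqueDiffOn_Ico 0 1) (by simp) (by simp) (ha 0 (by simp)).contDiffAt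

theorem hasL2Bound_of_abs_le {γ C : ℝ} {w : ℝ → ℝ → ℝ} (hC : 0 ≤ C)
    (h : ∀ t x, |w t x| ≤ C * Real.exp (-γ * t)) : HasL2Bound γ w := by
  refine ⟨C + 1, by positivity, fun t _ => ?_⟩
  refine (eLpNorm_le_of_ae_bound (Eventually.of_forall (h t))).trans_lt ?_
  simp only [Measure.restrict_apply_univ, Real.volume_Ioo, sub_zero, ENNReal.ofReal_one,
    ENNReal.one_rpow, one_mul]
  exact (ENNReal.ofReal_lt_ofReal_iff (by positivity)).2 (by gcongr; exact lt_add_one C)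

theorem hasL2Bound_dampedSolution (γ : ℝ) (hφ : ∀ s, |φ s| ≤ B) :
    HasL2Bound γ (dampedSolution γ φ) :=
  hasL2Bound_of_abs_le (mul_nonneg zero_le_two ((abs_nonneg _).trans (hφ 0)))
    (abs_dampedSolution_le γ hφ)

theorem dampedSolution_heat (γ : ℝ) (hφm : Measurable φ) (hφ : ∀ s, |φ s| ≤ B) {t : ℝ}
    (ht : t ≤ 0) {x : ℝ} (hx : x ∈ Ico 0 1) :
    derivWithin (fun s => dampedSolution γ φ s x) (Iic 0) t
      = iteratedDerivWithin 2 (dampedSolution γ φ t) (Ico 0 1) x - γ * dampedSolution γ φ t x := by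
  have hmem {y : ℝ} (hy : y ∈ Ico 0 1) : y ∈ Ioo (-1 : ℝ) 1 := ⟨by linarith [hy.1], hy.2⟩
  have htime : HasDerivAt (fun s => dampedSolution γ φ s x) _ t :=
    (((hasDerivAt_id t).const_mul (-γ)).exp).mul (hasDerivAt_stripSolution_fst hφm hφ t (hmem hx))
  have hspace (y : ℝ) (hy : y ∈ Ico 0 1) :
      iteratedDerivWithin 1 (dampedSolution γ φ t) (Ico 0 1) y
        = Real.exp (-γ * t) * stripFlux φ t y := by
    rw [iteratedDerivWithin_one]
    exact ((hasDerivAt_stripSolution_snd hφm hφ t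
      (hmem hy)).const_mul _).hasDerivWithinAt.derivWithin (uniqueDiffOn_Ico 0 1 y hy)
  have hspace₂ := ((hasDerivAt_stripFlux hφm hφ t (hmem hx)).const_mul
    (Real.exp (-γ * t))).hasDerivWithinAt.derivWithin (uniqueDiffOn_Ico 0 1 x hx)
  rw [htime.hasDerivWithinAt.derivWithin (uniqueDiffOn_Iic 0 t ht), iteratedDerivWithin_succ,
    derivWithin_congr hspace (hspace x hx), hspace₂, dampedSolution, id]
  ring

theorem isClassicalSolution_dampedSolution {γ : ℝ} {u : ℝ → ℝ} (hφc : Continuous φ)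
    (hφ : ∀ s, |φ s| ≤ B)
    (hu : ∀ t ≤ 0, φ t + halfLineSolution φ t 2 = Real.exp (γ * t) * u t) :
    IsClassicalSolution γ u (dampedSolution γ φ) where
  continuousOn := (continuous_dampedSolution γ hφc hφ).continuousOn
  memC1C2 r hr hr1 := memC1C2_dampedSolution γ hφc hφ hr hr1.le <|
    contDiffOn_slice (convex_Iic 0) (uniqueDiffOn_Iic 0) (isOpen_univ.prod isOpen_Ioo)
      (prod_mono (subset_univ _) fun x hx => ⟨by linarith [hx.1], hx.2.trans_lt hr1⟩)
      (contDiffOn_infty.1 (contDiffOn_stripSolution hφc.measurable hφ) 2)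
  heat _ ht _ hx := dampedSolution_heat γ hφc.measurable hφ ht hx
  neumann t _ := by
    rw [← iteratedDerivWithin_one]
    exact (dampedSolution_mem_spaceA γ hφc hφ t).2.2 0
  dirichlet t ht := by
    rw [dampedSolution, stripSolution_one, hu t ht, ← mul_assoc, ← Real.exp_add]
    simp

end DampedSolution

/-! ### Completeness of the cosines `cos ((n + 1 / 2) π x)` on `[0, 1]` -/

section CosineCompleteness

variable {f : ℝ → ℝ}

theorem integral_mul_cos_int_eq_zero
    (h : ∀ n : ℕ, ∫ x in (0 : ℝ)..1, f x * Real.cos ((n + 1 / 2) * Real.pi * x) = 0) (m : ℤ) :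
    ∫ x in (0 : ℝ)..1, f x * Real.cos ((m + 1 / 2) * Real.pi * x) = 0 := by
  cases m with
  | ofNat n => exact h n
  | negSucc n =>
    refine (intervalIntegral.integral_congr fun x _ => congrArg (f x * ·) ?_).trans (h n)
    rw [← Real.cos_neg, Int.cast_negSucc]
    congr 1
    push_cast
    ring

theorem integral_mul_cos_mul_cos_pow_eq_zero (hf : ContinuousOn f (Icc 0 1))
    (h : ∀ n : ℕ, ∫ x in (0 : ℝ)..1, f x * Real.cos ((n + 1 / 2) * Real.pi * x) = 0) (k : ℕ)
    (m : ℤ) : ∫ x in (0 : ℝ)..1,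
      f x * Real.cos ((m + 1 / 2) * Real.pi * x) * Real.cos (Real.pi * x) ^ k = 0 := by
  induction k generalizing m with
  | zero => simpa only [pow_zero, mul_one] using integral_mul_cos_int_eq_zero h m
  | succ k ih =>
    have hint (m : ℤ) : IntervalIntegrable (fun x => f x * Real.cos ((m + 1 / 2) * Real.pi * x)
        * Real.cos (Real.pi * x) ^ k) volume 0 1 := by
      refine ContinuousOn.intervalIntegrable ?_
      rw [uIcc_of_le zero_le_one]
      fun_prop
    have hcos (x : ℝ) :
        f x * Real.cos ((m + 1 / 2) * Real.pi * x) * Real.cos (Real.pi * x) ^ (k + 1)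
        = 1 / 2 * (f x * Real.cos (((m + 1 : ℤ) + 1 / 2) * Real.pi * x) * Real.cos (Real.pi * x) ^ k
          + f x * Real.cos (((m - 1 : ℤ) + 1 / 2) * Real.pi * x) * Real.cos (Real.pi * x) ^ k) := by
      have hadd := Real.cos_add ((m + 1 / 2) * Real.pi * x) (Real.pi * x)
      have hsub := Real.cos_sub ((m + 1 / 2) * Real.pi * x) (Real.pi * x)
      rw [show ((m + 1 : ℤ) + 1 / 2) * Real.pi * x = (m + 1 / 2) * Real.pi * x + Real.pi * x by
        push_cast; ring, show ((m - 1 : ℤ) + 1 / 2) * Real.pi * x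
          = (m + 1 / 2) * Real.pi * x - Real.pi * x by push_cast; ring, hadd, hsub]
      ring
    simp only [hcos]
    rw [intervalIntegral.integral_const_mul, intervalIntegral.integral_add (hint _) (hint _), ih,
      ih, add_zero, mul_zero]

theorem integral_mul_cos_mul_eval_cos_eq_zero (hf : ContinuousOn f (Icc 0 1))
    (h : ∀ n : ℕ, ∫ x in (0 : ℝ)..1, f x * Real.cos ((n + 1 / 2) * Real.pi * x) = 0)
    (p : Polynomial ℝ) : ∫ x in (0 : ℝ)..1,
      f x * Real.cos (Real.pi / 2 * x) * p.eval (Real.cos (Real.pi * x)) = 0 := by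
  have hmonomial (k : ℕ) := integral_mul_cos_mul_cos_pow_eq_zero hf h k 0
  simp only [Int.cast_zero, zero_add, one_div_mul_eq_div] at hmonomial
  simp only [Polynomial.eval_eq_sum_range, Finset.mul_sum, mul_left_comm _ (Polynomial.coeff _ _)]
  rw [intervalIntegral.integral_finsetSum fun k _ => ?_]
  · simp only [intervalIntegral.integral_const_mul, hmonomial, mul_zero, Finset.sum_const_zero]
  · refine ContinuousOn.intervalIntegrable ?_
    rw [uIcc_of_le zero_le_one]
    fun_prop

theorem exists_polynomial_abs_sub_eval_cos_le {F : ℝ → ℝ} (hF : ContinuousOn F (Icc 0 1)) {ε : ℝ}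
    (hε : 0 < ε) :
    ∃ p : Polynomial ℝ, ∀ x ∈ Icc (0 : ℝ) 1, |F x - p.eval (Real.cos (Real.pi * x))| ≤ ε := by
  have hmaps : MapsTo (fun c => Real.arccos c / Real.pi) (Icc (-1) 1) (Icc 0 1) := fun c _ =>
    ⟨by have := Real.arccos_nonneg c; positivity,
      div_le_one_of_le₀ (Real.arccos_le_pi c) Real.pi_pos.le⟩
  obtain ⟨p, hp⟩ := exists_polynomial_near_of_continuousOn (-1) 1 _
    (hF.comp (Real.continuous_arccos.div_const Real.pi).continuousOn hmaps) ε hε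
  refine ⟨p, fun x hx => ?_⟩
  have hpx := hp (Real.cos (Real.pi * x)) (Real.cos_mem_Icc _)
  rw [Function.comp_apply, Real.arccos_cos (mul_nonneg Real.pi_pos.le hx.1)
    (mul_le_of_le_one_right Real.pi_pos.le hx.2), mul_div_cancel_left₀ x Real.pi_ne_zero] at hpx
  rw [abs_sub_comm]
  exact hpx.le

theorem eqOn_zero_of_integral_mul_eval_cos_eq_zero {F : ℝ → ℝ} (hF : ContinuousOn F (Icc 0 1))
    (h : ∀ p : Polynomial ℝ, ∫ x in (0 : ℝ)..1, F x * p.eval (Real.cos (Real.pi * x)) = 0) :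
    EqOn F 0 (Icc 0 1) := by
  have hint {G : ℝ → ℝ} (hG : ContinuousOn G (Icc 0 1)) : IntervalIntegrable G volume 0 1 :=
    ContinuousOn.intervalIntegrable (by rwa [uIcc_of_le zero_le_one])
  have hle (ε : ℝ) (hε : 0 < ε) : ∫ x in (0 : ℝ)..1, F x ^ 2 ≤ ε * ∫ x in (0 : ℝ)..1, |F x| := by
    obtain ⟨p, hp⟩ := exists_polynomial_abs_sub_eval_cos_le hF hε
    have hpc : ContinuousOn (fun x => p.eval (Real.cos (Real.pi * x))) (Icc 0 1) := by fun_prop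
    calc ∫ x in (0 : ℝ)..1, F x ^ 2
        = ∫ x in (0 : ℝ)..1, F x * (F x - p.eval (Real.cos (Real.pi * x))) := by
          simp only [mul_sub, ← sq]
          have hsub := intervalIntegral.integral_sub (hint (hF.pow 2)) (hint (hF.mul hpc))
          exact ((hsub.trans (congrArg _ (h p))).trans (sub_zero _)).symm
      _ ≤ ∫ x in (0 : ℝ)..1, ε * |F x| := by
          refine intervalIntegral.integral_mono_on zero_le_one (hint (hF.mul (hF.sub hpc)))
            (hint (hF.abs.const_mul ε)) fun x hx => ?_
          rw [mul_comm ε]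
          exact (le_abs_self _).trans
            ((abs_mul _ _).trans_le (mul_le_mul_of_nonneg_left (hp x hx) (abs_nonneg _)))
      _ = ε * ∫ x in (0 : ℝ)..1, |F x| := intervalIntegral.integral_const_mul _ _
  have hsq : ∫ x in (0 : ℝ)..1, F x ^ 2 = 0 := by
    have hlim : Tendsto (fun ε : ℝ => ε * ∫ x in (0 : ℝ)..1, |F x|) (𝓝[>] 0) (𝓝 0) :=
      ((continuous_mul_const _).tendsto' 0 0 (zero_mul _)).mono_left nhdsWithin_le_nhds
    exact le_antisymm (ge_of_tendsto hlim (eventually_nhdsWithin_of_forall hle))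
      (intervalIntegral.integral_nonneg zero_le_one fun x _ => sq_nonneg _)
  rw [intervalIntegral.integral_eq_zero_iff_of_le_of_nonneg_ae zero_le_one
    (Eventually.of_forall fun x => sq_nonneg _) (hint (hF.pow 2)),
    restrict_Ioc_eq_restrict_Icc] at hsq
  exact fun x hx => pow_eq_zero_iff two_ne_zero |>.1
    (Measure.eqOn_Icc_of_ae_eq volume zero_ne_one hsq (hF.pow 2) continuousOn_const hx)

theorem eqOn_zero_of_integral_cos_eq_zero (hf : ContinuousOn f (Icc 0 1))
    (h : ∀ n : ℕ, ∫ x in (0 : ℝ)..1, f x * Real.cos ((n + 1 / 2) * Real.pi * x) = 0) :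
    EqOn f 0 (Icc 0 1) := by
  have hmul := eqOn_zero_of_integral_mul_eval_cos_eq_zero
    (F := fun x => f x * Real.cos (Real.pi / 2 * x)) (by fun_prop)
    (integral_mul_cos_mul_eval_cos_eq_zero hf h)
  have hIco : EqOn f 0 (Ico 0 1) := fun x hx => by
    have hcos : 0 < Real.cos (Real.pi / 2 * x) := Real.cos_pos_of_mem_Ioo
      ⟨by nlinarith [Real.pi_pos, hx.1], by nlinarith [Real.pi_pos, hx.2]⟩
    exact (mul_eq_zero.1 (hmul (Ico_subset_Icc_self hx))).resolve_right hcos.ne'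
  exact hIco.of_subset_closure hf continuousOn_const Ico_subset_Icc_self
    (closure_Ico zero_ne_one).ge

end CosineCompleteness

/-! ### Uniqueness -/

/-- The coefficient `∫₀ʳ f(x) cos(a x) dx` of `f` at the frequency `a` on `[0, r]`. -/
noncomputable def cosCoeff (r a : ℝ) (f : ℝ → ℝ) : ℝ :=
  ∫ x in (0 : ℝ)..r, f x * Real.cos (a * x)

section CosCoeff

variable {f g : ℝ → ℝ} {r a : ℝ}

theorem cosCoeff_congr (hr : 0 ≤ r) (h : EqOn f g (Icc 0 r)) : cosCoeff r a f = cosCoeff r a g :=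
  intervalIntegral.integral_congr fun x hx => by
    rw [uIcc_of_le hr] at hx
    simp only [h hx]

theorem intervalIntegrable_mul_cos (hr : 0 ≤ r) (hf : ContinuousOn f (Icc 0 r)) :
    IntervalIntegrable (fun x => f x * Real.cos (a * x)) volume 0 r := by
  refine ContinuousOn.intervalIntegrable ?_
  rw [uIcc_of_le hr]
  fun_prop

theorem cosCoeff_sub (hr : 0 ≤ r) (hf : ContinuousOn f (Icc 0 r)) (hg : ContinuousOn g (Icc 0 r)) :
    cosCoeff r a (fun x => f x - g x) = cosCoeff r a f - cosCoeff r a g := by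
  simp only [cosCoeff, sub_mul]
  exact intervalIntegral.integral_sub (intervalIntegrable_mul_cos hr hf)
    (intervalIntegrable_mul_cos hr hg)

theorem continuous_cosCoeff (hf : Continuous f) :
    Continuous fun p : ℝ × ℝ => cosCoeff p.1 p.2 f :=
  intervalIntegral.continuous_parametric_intervalIntegral_of_continuous
    (f := fun (p : ℝ × ℝ) x => f x * Real.cos (p.2 * x)) (by fun_prop) continuous_fst

theorem exists_clm_eq_cosCoeff (hr : 0 ≤ r) (a : ℝ) :
    ∃ L : C(Icc (0 : ℝ) r, ℝ) →L[ℝ] ℝ,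
      ∀ (f : C(Icc (0 : ℝ) r, ℝ)) (g : ℝ → ℝ), (∀ x, f x = g x) → L f = cosCoeff r a g := by
  let ψ : C(Icc (0 : ℝ) r, ℝ) := ⟨fun x => Real.cos (a * x), by fun_prop⟩
  refine ⟨(ContinuousMap.evalCLM ℝ ⟨r, hr, le_rfl⟩).comp
    ((primitive hr).comp (ContinuousLinearMap.mul ℝ _ ψ)), fun f g hfg => ?_⟩
  change ∫ x in (0 : ℝ)..r, IccExtend hr (ψ * f) x = _
  refine intervalIntegral.integral_congr fun x hx => ?_
  rw [uIcc_of_le hr] at hx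
  simp only [IccExtend_of_mem hr _ hx, ContinuousMap.mul_apply, hfg]
  exact mul_comm _ _

theorem cosCoeff_of_hasDerivAt_two {f₁ f₂ : ℝ → ℝ} (hr : 0 ≤ r) (hf : ContinuousOn f (Icc 0 r))
    (hf₁ : ContinuousOn f₁ (Icc 0 r)) (hf₂ : ContinuousOn f₂ (Icc 0 r))
    (h₁ : ∀ x ∈ Ioo 0 r, HasDerivAt f (f₁ x) x) (h₂ : ∀ x ∈ Ioo 0 r, HasDerivAt f₁ (f₂ x) x)
    (a : ℝ) : cosCoeff r a f₂ = f₁ r * Real.cos (a * r) - f₁ 0 + a * Real.sin (a * r) * f r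
      - a ^ 2 * cosCoeff r a f := by
  have hderiv (x : ℝ) (hx : x ∈ Ioo 0 r) : HasDerivAt
      (fun x => f₁ x * Real.cos (a * x) + f x * (a * Real.sin (a * x)))
      (f₂ x * Real.cos (a * x) + a ^ 2 * (f x * Real.cos (a * x))) x := by
    have hlin : HasDerivAt (fun x : ℝ => a * x) a x := by simpa using (hasDerivAt_id x).const_mul a
    exact (((h₂ x hx).mul hlin.cos).add ((h₁ x hx).mul (hlin.sin.const_mul a))).congr_deriv
      (by ring)
  have hint₀ := intervalIntegrable_mul_cos (a := a) hr hf
  have hint₂ := intervalIntegrable_mul_cos (a := a) hr hf₂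
  have hftc := intervalIntegral.integral_eq_sub_of_hasDerivAt_of_le hr (by fun_prop) hderiv
    (hint₂.add (hint₀.const_mul _))
  rw [intervalIntegral.integral_add hint₂ (hint₀.const_mul _),
    intervalIntegral.integral_const_mul] at hftc
  simp only [mul_zero, Real.cos_zero, Real.sin_zero, mul_one, add_zero] at hftc
  simp only [cosCoeff]
  linarith

theorem cosCoeff_iteratedDerivWithin_two (hr : 0 < r) (hf : ContDiffOn ℝ 2 f (Icc 0 r))
    (h0 : derivWithin f (Icc 0 r) 0 = 0) (ha : Real.cos (a * r) = 0) :
    cosCoeff r a (iteratedDerivWithin 2 f (Icc 0 r))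
      = a * Real.sin (a * r) * f r - a ^ 2 * cosCoeff r a f := by
  have hu := uniqueDiffOn_Icc hr
  have hnhds {x : ℝ} (hx : x ∈ Ioo 0 r) : Icc 0 r ∈ 𝓝 x := Icc_mem_nhds hx.1 hx.2
  have hf' := hf
  rw [← one_add_one_eq_two] at hf'
  obtain ⟨hd, -, hd₁⟩ := (contDiffOn_succ_iff_derivWithin hu).1 hf'
  rw [cosCoeff_of_hasDerivAt_two hr.le hf.continuousOn hd₁.continuousOn
    (hf.continuousOn_iteratedDerivWithin le_rfl hu)
    (fun x hx => (hd x (Ioo_subset_Icc_self hx)).hasDerivWithinAt.hasDerivAt (hnhds hx))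
    (fun x hx => ?_) a, ha, h0]
  · ring
  · rw [iteratedDerivWithin_succ, iteratedDerivWithin_one]
    exact ((hd₁.differentiableOn one_ne_zero) x
      (Ioo_subset_Icc_self hx)).hasDerivWithinAt.hasDerivAt (hnhds hx)

theorem abs_cosCoeff_one_le (hf : ContinuousOn f (Icc 0 1)) {C : ℝ} (hC : 0 ≤ C)
    (h : eLpNorm f 2 (volume.restrict (Ioo 0 1)) ≤ ENNReal.ofReal C) (a : ℝ) :
    |cosCoeff 1 a f| ≤ C := by
  have hprob : IsProbabilityMeasure (volume.restrict (Ioo (0 : ℝ) 1)) := ⟨by simp⟩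
  have hm : AEStronglyMeasurable f (volume.restrict (Ioo 0 1)) :=
    (hf.mono Ioo_subset_Icc_self).aestronglyMeasurable measurableSet_Ioo
  have hcos (x : ℝ) : ‖f x * Real.cos (a * x)‖ₑ ≤ ‖f x‖ₑ := by
    rw [enorm_mul]
    refine mul_le_of_le_one_right zero_le ?_
    rw [← ofReal_norm, ENNReal.ofReal_le_one]
    exact Real.abs_cos_le_one _
  have hle : ‖cosCoeff 1 a f‖ₑ ≤ ENNReal.ofReal C := by
    rw [cosCoeff, intervalIntegral.integral_of_le zero_le_one, integral_Ioc_eq_integral_Ioo]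
    calc _ ≤ ∫⁻ x in Ioo 0 1, ‖f x * Real.cos (a * x)‖ₑ := enorm_integral_le_lintegral_enorm _
      _ ≤ eLpNorm f 1 (volume.restrict (Ioo 0 1)) := by
        rw [eLpNorm_one_eq_lintegral_enorm]
        exact lintegral_mono hcos
      _ ≤ eLpNorm f 2 (volume.restrict (Ioo 0 1)) :=
        eLpNorm_le_eLpNorm_of_exponent_le one_le_two hm
      _ ≤ ENNReal.ofReal C := h
  rw [← ofReal_norm] at hle
  exact (ENNReal.ofReal_le_ofReal_iff hC).1 hle

end CosCoeff

theorem eq_of_forall_lt_apply_eq {E : Type*} [TopologicalSpace E] [T2Space E] {a b : ℝ}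
    (hab : a < b) {f g : C(Icc a b, E)} (h : ∀ x : Icc a b, (x : ℝ) < b → f x = g x) : f = g := by
  have hIco : EqOn (IccExtend hab.le f) (IccExtend hab.le g) (Ico a b) := fun x hx => by
    have hx' := Ico_subset_Icc_self hx
    rw [IccExtend_of_mem _ _ hx', IccExtend_of_mem _ _ hx']
    exact h _ hx.2
  have hIcc := hIco.closure f.continuous.Icc_extend' g.continuous.Icc_extend'
  rw [closure_Ico hab.ne] at hIcc
  ext x
  simpa only [IccExtend_val] using hIcc x.2

theorem Ico_eventuallyEq_Icc {a b r x : ℝ} (hr : r ≤ b) (hx : x < r) :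
    Ico a b =ᶠ[𝓝 x] Icc a r := by
  filter_upwards [gt_mem_nhds hx] with y hy
  exact propext ⟨fun h => ⟨h.1, hy.le⟩, fun h => ⟨h.1, hy.trans_le hr⟩⟩

theorem MemC1C2.exists_curves {γ r : ℝ} {w : ℝ → ℝ → ℝ} (h : MemC1C2 w r) (hr : 0 < r)
    (hr1 : r ≤ 1) (hheat : ∀ t ≤ 0, ∀ x ∈ Ico (0 : ℝ) 1, derivWithin (fun s => w s x) (Iic 0) t
      = iteratedDerivWithin 2 (w t) (Ico 0 1) x - γ * w t x) :
    ∃ W₀ W₂ : ℝ → C(Icc (0 : ℝ) r, ℝ), ContDiffOn ℝ 1 W₀ (Iic 0) ∧ ContDiffOn ℝ 1 W₂ (Iic 0) ∧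
      (∀ t ≤ 0, ∀ x : Icc (0 : ℝ) r, W₀ t x = w t x) ∧
      (∀ t ≤ 0, ∀ x : Icc (0 : ℝ) r, W₂ t x = iteratedDerivWithin 2 (w t) (Icc 0 r) x) ∧
      ∀ t ≤ 0, HasDerivWithinAt W₀ (W₂ t - γ • W₀ t) (Iic 0) t := by
  obtain ⟨W₀, hW₀, h₀⟩ := h.2 0 zero_le_two
  obtain ⟨W₂, hW₂, h₂⟩ := h.2 2 le_rfl
  simp only [iteratedDerivWithin_zero] at h₀
  refine ⟨W₀, W₂, hW₀, hW₂, h₀, h₂, fun t ht => ?_⟩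
  have hd := ((hW₀.differentiableOn one_ne_zero) t ht).hasDerivWithinAt
  refine hd.congr_deriv (eq_of_forall_lt_apply_eq hr fun x hx => ?_)
  have heval : HasDerivWithinAt (fun s => w s x) (derivWithin W₀ (Iic 0) t x) (Iic 0) t :=
    ((ContinuousMap.evalCLM ℝ x).hasFDerivAt.comp_hasDerivWithinAt t hd).congr
      (fun s hs => (h₀ s hs x).symm) (h₀ t ht x).symm
  have hx_heat := hheat t ht x ⟨x.2.1, hx.trans_le hr1⟩
  rw [heval.derivWithin (uniqueDiffOn_Iic 0 t ht), iteratedDerivWithin,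
    iteratedFDerivWithin_congr_set (Ico_eventuallyEq_Icc hr1 hx), ← iteratedDerivWithin] at hx_heat
  rw [hx_heat, ContinuousMap.sub_apply, ContinuousMap.smul_apply, h₂ t ht, h₀ t ht, smul_eq_mul]

/-- What is left of Green's identity on `[T, t] × [0, r]` for `w` and the adjoint solution
`e^((γ + a²) s) cos (a x)`; it vanishes for the solutions `w` when `cos (a r) = 0`. -/
noncomputable def greenDefect (γ : ℝ) (w : ℝ → ℝ → ℝ) (T t r a : ℝ) : ℝ :=
  Real.exp ((γ + a ^ 2) * t) * cosCoeff r a (w t) - Real.exp ((γ + a ^ 2) * T) * cosCoeff r a (w T)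
    - ∫ s in T..t, Real.exp ((γ + a ^ 2) * s) * (a * Real.sin (a * r) * w s r)

theorem continuous_greenDefect (γ : ℝ) {w : ℝ → ℝ → ℝ}
    (hw : Continuous fun p : ℝ × ℝ => w p.1 p.2) (T t : ℝ) :
    Continuous fun p : ℝ × ℝ => greenDefect γ w T t p.1 p.2 := by
  have hcoeff (s : ℝ) := continuous_cosCoeff (hw.comp (.prodMk_right s))
  have hflux : Continuous fun p : ℝ × ℝ =>
      ∫ s in T..t, Real.exp ((γ + p.2 ^ 2) * s) * (p.2 * Real.sin (p.2 * p.1) * w s p.1) :=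
    intervalIntegral.continuous_parametric_intervalIntegral_of_continuous'
      (by
        have := hw.comp (by fun_prop : Continuous fun q : (ℝ × ℝ) × ℝ => (q.2, q.1.1))
        fun_prop) T t
  exact (((by fun_prop : Continuous fun p : ℝ × ℝ => Real.exp ((γ + p.2 ^ 2) * t)).mul
    (hcoeff t)).sub ((by fun_prop : Continuous fun p : ℝ × ℝ => Real.exp ((γ + p.2 ^ 2) * T)).mul
      (hcoeff T))).sub hflux

theorem greenDefect_congr {γ T t r a : ℝ} {v w : ℝ → ℝ → ℝ} (hr : 0 ≤ r) (hT : T ≤ t)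
    (h : ∀ s ∈ Icc T t, EqOn (v s) (w s) (Icc 0 r)) :
    greenDefect γ v T t r a = greenDefect γ w T t r a := by
  rw [greenDefect, greenDefect, cosCoeff_congr hr (h t ⟨hT, le_rfl⟩),
    cosCoeff_congr hr (h T ⟨le_rfl, hT⟩)]
  congr 1
  refine intervalIntegral.integral_congr fun s hs => ?_
  rw [uIcc_of_le hT] at hs
  simp only [h s hs ⟨hr, le_rfl⟩]

namespace IsClassicalSolution

variable {γ : ℝ} {u : ℝ → ℝ} {w w' : ℝ → ℝ → ℝ} {r a T t : ℝ}

theorem continuousOn_right (h : IsClassicalSolution γ u w) (ht : t ≤ 0) :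
    ContinuousOn (w t) (Icc 0 1) :=
  continuousOn_of_mem_of_continuousOn_prod h.continuousOn ht

theorem exists_continuous_extension (h : IsClassicalSolution γ u w) :
    ∃ W : ℝ → ℝ → ℝ, Continuous (fun p : ℝ × ℝ => W p.1 p.2) ∧
      ∀ s ≤ 0, EqOn (W s) (w s) (Icc 0 1) := by
  refine ⟨fun s x => w (min s 0) (projIcc 0 1 zero_le_one x), ?_, fun s hs x hx => ?_⟩
  · have := continuous_projIcc (a := (0 : ℝ)) (b := 1) (h := zero_le_one)
    exact h.continuousOn.comp_continuous (f := fun p : ℝ × ℝ =>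
      (min p.1 0, (projIcc (0 : ℝ) 1 zero_le_one p.2 : ℝ))) (by fun_prop)
      fun p => ⟨min_le_right p.1 0, Subtype.coe_prop _⟩
  · simp only [min_eq_left hs, projIcc_of_mem _ hx]

theorem hasDerivWithinAt_exp_mul_cosCoeff (h : IsClassicalSolution γ u w) (hr : 0 < r)
    (hr1 : r < 1) (ha : Real.cos (a * r) = 0) (ht : t ≤ 0) :
    HasDerivWithinAt (fun s => Real.exp ((γ + a ^ 2) * s) * cosCoeff r a (w s))
      (Real.exp ((γ + a ^ 2) * t) * (a * Real.sin (a * r) * w t r)) (Iic 0) t := by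
  have hmem := h.memC1C2 r hr hr1
  obtain ⟨W₀, W₂, -, -, h₀, h₂, hd⟩ := hmem.exists_curves hr hr1.le h.heat
  obtain ⟨L, hL⟩ := exists_clm_eq_cosCoeff hr.le a
  have hneumann : derivWithin (w t) (Icc 0 r) 0 = 0 := by
    rw [← derivWithin_congr_set (Ico_eventuallyEq_Icc hr1.le hr)]
    exact h.neumann t ht
  have hcoeff : HasDerivWithinAt (fun s => cosCoeff r a (w s))
      (a * Real.sin (a * r) * w t r - (γ + a ^ 2) * cosCoeff r a (w t)) (Iic 0) t := by
    refine ((L.hasFDerivAt.comp_hasDerivWithinAt t (hd t ht)).congr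
      (fun s hs => (hL _ _ (h₀ s hs)).symm) (hL _ _ (h₀ t ht)).symm).congr_deriv ?_
    rw [map_sub, map_smul, hL _ _ (h₂ t ht), hL _ _ (h₀ t ht), smul_eq_mul,
      cosCoeff_iteratedDerivWithin_two hr (hmem.1 t ht) hneumann ha]
    ring
  have hexp : HasDerivWithinAt (fun s : ℝ => Real.exp ((γ + a ^ 2) * s))
      (Real.exp ((γ + a ^ 2) * t) * (γ + a ^ 2)) (Iic 0) t := by
    simpa using (((hasDerivAt_id t).const_mul (γ + a ^ 2)).exp).hasDerivWithinAt
  exact (hexp.mul hcoeff).congr_deriv (by ring)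

theorem greenDefect_eq_zero_of_lt_one (h : IsClassicalSolution γ u w) (hr : 0 < r) (hr1 : r < 1)
    (ha : Real.cos (a * r) = 0) (hT : T ≤ t) (ht : t ≤ 0) : greenDefect γ w T t r a = 0 := by
  have hderiv {s : ℝ} (hs : s ≤ 0) := h.hasDerivWithinAt_exp_mul_cosCoeff hr hr1 ha hs
  have hw : ContinuousOn (fun s => w s r) (uIcc T t) := by
    rw [uIcc_of_le hT]
    exact h.continuousOn.comp (f := fun s : ℝ => (s, r)) (by fun_prop)
      fun s hs => ⟨hs.2.trans ht, hr.le, hr1.le⟩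
  refine sub_eq_zero.2 (intervalIntegral.integral_eq_sub_of_hasDerivAt_of_le hT
    (fun s hs => (hderiv (hs.2.trans ht)).continuousWithinAt.mono fun x hx => hx.2.trans ht)
    (fun s hs => (hderiv (hs.2.le.trans ht)).hasDerivAt (Iic_mem_nhds (hs.2.trans_le ht)))
    (ContinuousOn.intervalIntegrable (by fun_prop))).symm

/-- On `[0, r]` with `r < 1` the solution is regular enough for Green's identity; letting `r → 1`
with frequency `a / r` only needs the continuity of `w`. -/
theorem greenDefect_one_eq_zero (h : IsClassicalSolution γ u w) (ha : Real.cos a = 0) (hT : T ≤ t)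
    (ht : t ≤ 0) : greenDefect γ w T t 1 a = 0 := by
  obtain ⟨W, hWc, hW⟩ := h.exists_continuous_extension
  have hdefect {r b : ℝ} (hr : r ∈ Ioc 0 1) :
      greenDefect γ W T t r b = greenDefect γ w T t r b :=
    greenDefect_congr hr.1.le hT fun s hs =>
      (hW s (hs.2.trans ht)).mono (Icc_subset_Icc_right hr.2)
  have hlim : Tendsto (fun r => greenDefect γ W T t r (a / r)) (𝓝[<] 1)
      (𝓝 (greenDefect γ W T t 1 a)) := by
    have hpair : Tendsto (fun r : ℝ => (r, a / r)) (𝓝[<] 1) (𝓝 (1, a)) := by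
      have : ContinuousAt (fun r : ℝ => (r, a / r)) 1 :=
        continuousAt_id.prodMk (continuousAt_const.div continuousAt_id one_ne_zero)
      simpa only [div_one] using this.tendsto.mono_left nhdsWithin_le_nhds
    have hcomp := ((continuous_greenDefect γ hWc T t).tendsto (1, a)).comp hpair
    exact hcomp
  have hzero : (fun r => greenDefect γ W T t r (a / r)) =ᶠ[𝓝[<] 1] 0 := by
    filter_upwards [Ioo_mem_nhdsLT zero_lt_one] with r hr
    rw [hdefect ⟨hr.1, hr.2.le⟩]
    exact h.greenDefect_eq_zero_of_lt_one hr.1 hr.2 (by rwa [div_mul_cancel₀ a hr.1.ne']) hT ht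
  rw [← hdefect (right_mem_Ioc.2 zero_lt_one)]
  exact tendsto_nhds_unique hlim (tendsto_const_nhds.congr' hzero.symm)

theorem exp_mul_cosCoeff_sub_eq (h : IsClassicalSolution γ u w) (h' : IsClassicalSolution γ u w')
    (ha : Real.cos a = 0) (hT : T ≤ t) (ht : t ≤ 0) :
    Real.exp ((γ + a ^ 2) * t) * (cosCoeff 1 a (w' t) - cosCoeff 1 a (w t))
      = Real.exp ((γ + a ^ 2) * T) * (cosCoeff 1 a (w' T) - cosCoeff 1 a (w T)) := by
  have hflux : ∫ s in T..t, Real.exp ((γ + a ^ 2) * s) * (a * Real.sin (a * 1) * w s 1)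
      = ∫ s in T..t, Real.exp ((γ + a ^ 2) * s) * (a * Real.sin (a * 1) * w' s 1) := by
    refine intervalIntegral.integral_congr fun s hs => ?_
    rw [uIcc_of_le hT] at hs
    simp only [h.dirichlet s (hs.2.trans ht), h'.dirichlet s (hs.2.trans ht)]
  have hw := h.greenDefect_one_eq_zero ha hT ht
  have hw' := h'.greenDefect_one_eq_zero ha hT ht
  rw [greenDefect] at hw hw'
  linarith

theorem cosCoeff_eq_of_hasL2Bound (h : IsClassicalSolution γ u w) (hb : HasL2Bound γ w)
    (h' : IsClassicalSolution γ u w') (hb' : HasL2Bound γ w') (ha : Real.cos a = 0) (ht : t ≤ 0) :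
    cosCoeff 1 a (w' t) = cosCoeff 1 a (w t) := by
  obtain ⟨C, hC, hw⟩ := hb
  obtain ⟨C', hC', hw'⟩ := hb'
  have hdecay (T : ℝ) (hT : T ≤ t) :
      |Real.exp ((γ + a ^ 2) * t) * (cosCoeff 1 a (w' t) - cosCoeff 1 a (w t))|
        ≤ (C' + C) * Real.exp (a ^ 2 * T) := by
    have hT0 := hT.trans ht
    have hle := abs_cosCoeff_one_le (h.continuousOn_right hT0) (by positivity) (hw T hT0).le a
    have hle' := abs_cosCoeff_one_le (h'.continuousOn_right hT0) (by positivity) (hw' T hT0).le a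
    rw [h.exp_mul_cosCoeff_sub_eq h' ha hT ht, abs_mul, Real.abs_exp]
    calc _ ≤ Real.exp ((γ + a ^ 2) * T) * (C' * Real.exp (-γ * T) + C * Real.exp (-γ * T)) :=
          mul_le_mul_of_nonneg_left ((abs_sub _ _).trans (add_le_add hle' hle)) (Real.exp_pos _).le
      _ = (C' + C) * (Real.exp ((γ + a ^ 2) * T) * Real.exp (-γ * T)) := by ring
      _ = (C' + C) * Real.exp (a ^ 2 * T) := by rw [← Real.exp_add]; congr 2; ring
  have ha0 : a ≠ 0 := by
    rintro rfl
    simp at ha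
  have hlim : Tendsto (fun T => (C' + C) * Real.exp (a ^ 2 * T)) atBot (𝓝 0) := by
    simpa using (Real.tendsto_exp_atBot.comp
      (tendsto_id.const_mul_atBot (by positivity : 0 < a ^ 2))).const_mul (C' + C)
  have hzero := abs_nonpos_iff.1 (ge_of_tendsto hlim (eventually_atBot.2 ⟨t, hdecay⟩))
  exact sub_eq_zero.1 ((mul_eq_zero.1 hzero).resolve_left (Real.exp_pos _).ne')

theorem eqOn_of_hasL2Bound (h : IsClassicalSolution γ u w) (hb : HasL2Bound γ w)
    (h' : IsClassicalSolution γ u w') (hb' : HasL2Bound γ w') (ht : t ≤ 0) :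
    EqOn (w' t) (w t) (Icc 0 1) := by
  have hc := h.continuousOn_right ht
  have hc' := h'.continuousOn_right ht
  have hzero := eqOn_zero_of_integral_cos_eq_zero (hc'.sub hc) fun n => by
    have hcos : Real.cos ((n + 1 / 2) * Real.pi) = 0 :=
      Real.cos_eq_zero_iff.2 ⟨n, by push_cast; ring⟩
    exact (cosCoeff_sub zero_le_one hc' hc).trans
      (sub_eq_zero.2 (h.cosCoeff_eq_of_hasL2Bound hb h' hb' hcos ht))
  exact fun x hx => sub_eq_zero.1 (hzero hx)

end IsClassicalSolution

/-! ### Regularity up to `x = 1` -/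

theorem IsClassicalSolution.contDiffOn_of_memC1C2_one {γ : ℝ} {u : ℝ → ℝ} {w : ℝ → ℝ → ℝ}
    (h : IsClassicalSolution γ u w) (hw : MemC1C2 w 1) : ContDiffOn ℝ 2 u (Iic 0) := by
  obtain ⟨W₀, W₂, hW₀, hW₂, h₀, -, hd⟩ := hw.exists_curves one_pos le_rfl h.heat
  have hW : ContDiffOn ℝ (1 + 1) W₀ (Iic 0) :=
    (contDiffOn_succ_iff_derivWithin (uniqueDiffOn_Iic 0)).2
      ⟨hW₀.differentiableOn one_ne_zero, by simp, (hW₂.sub (hW₀.const_smul γ)).congr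
        fun t ht => (hd t ht).derivWithin (uniqueDiffOn_Iic 0 t ht)⟩
  rw [one_add_one_eq_two] at hW
  have h1 : (1 : ℝ) ∈ Icc (0 : ℝ) 1 := right_mem_Icc.2 zero_le_one
  refine ((ContinuousMap.evalCLM ℝ ⟨1, h1⟩).contDiff.comp_contDiffOn hW).congr fun t ht => ?_
  exact (h.dirichlet t ht).symm.trans (h₀ t ht ⟨1, h1⟩).symm

theorem exists_contDiff_eqOn_Iic (n : ℕ) {f : ℝ → ℝ} (hf : ContDiffOn ℝ n f (Iic 0)) :
    ∃ g : ℝ → ℝ, ContDiff ℝ n g ∧ EqOn g f (Iic 0) := by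
  induction n generalizing f with
  | zero =>
    refine ⟨fun t => f (min t 0), contDiff_zero.2 ?_, fun t ht => congrArg f (min_eq_left ht)⟩
    exact hf.continuousOn.comp_continuous (by fun_prop) fun t => min_le_right t 0
  | succ n ih =>
    push_cast at hf ⊢
    obtain ⟨hd, -, hd'⟩ := (contDiffOn_succ_iff_derivWithin (uniqueDiffOn_Iic 0)).1 hf
    obtain ⟨e, he, hef⟩ := ih hd'
    have hg (t : ℝ) : HasDerivAt (fun t => f 0 + ∫ s in (0 : ℝ)..t, e s) (e t) t :=
      (he.continuous.integral_hasStrictDerivAt 0 t).hasDerivAt.const_add _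
    refine ⟨fun t => f 0 + ∫ s in (0 : ℝ)..t, e s, ?_, fun t ht => ?_⟩
    · refine contDiff_succ_iff_deriv.2 ⟨fun t => (hg t).differentiableAt,
        fun h => absurd h (WithTop.natCast_ne_top n), ?_⟩
      rwa [funext fun t => (hg t).deriv]
    · have hftc := intervalIntegral.integral_eq_sub_of_hasDerivAt_of_le ht
        (hf.continuousOn.mono Icc_subset_Iic_self)
        (fun s hs => hef hs.2.le ▸
          (hd s hs.2.le).hasDerivWithinAt.hasDerivAt (Iic_mem_nhds hs.2))
        (he.continuous.intervalIntegrable t 0)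
      simp only [intervalIntegral.integral_symm t 0, hftc]
      ring

theorem exists_eq_add_of_contDiffOn_Iic {n : ℕ} {φ : ℝ → ℝ} {B c : ℝ} (hφc : Continuous φ)
    (hφ : ∀ s, |φ s| ≤ B) (hφn : ContDiffOn ℝ n φ (Iic 0)) (hc : c < 0) :
    ∃ φ₁ φ₂ : ℝ → ℝ, ContDiff ℝ n φ₁ ∧ HasCompactSupport φ₁ ∧ Continuous φ₂ ∧
      (∃ C, ∀ s, |φ₂ s| ≤ C) ∧ (∀ s, c < s → φ₂ s = 0) ∧ ∀ s ≤ 0, φ s = φ₁ s + φ₂ s := by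
  obtain ⟨ψ, hψ, hψφ⟩ := exists_contDiff_eqOn_Iic n hφn
  let χ : ContDiffBump (c / 2) := ⟨-c / 2, -c / 2 + 1, by linarith, by linarith⟩
  have hχ (s : ℝ) (hcs : c ≤ s) (hs : s ≤ 0) : χ s = 1 := by
    refine χ.one_of_mem_closedBall ?_
    rw [Metric.mem_closedBall, Real.dist_eq, abs_le]
    constructor <;> simp only [χ] <;> linarith
  have hφ₁ : ContDiff ℝ n fun s => χ s * ψ s := χ.contDiff.mul hψ
  have hsupp : HasCompactSupport fun s => χ s * ψ s := χ.hasCompactSupport.mul_right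
  have heq (s : ℝ) (hcs : c ≤ s) (hs : s ≤ 0) : φ s - χ s * ψ s = 0 := by
    rw [hχ s hcs hs, one_mul, hψφ hs, sub_self]
  obtain ⟨B₁, hB₁⟩ := hsupp.exists_bound_of_continuous hφ₁.continuous
  refine ⟨_, fun s => φ (min s c) - χ (min s c) * ψ (min s c), hφ₁, hsupp,
    (hφc.sub hφ₁.continuous).comp (by fun_prop : Continuous fun s => min s c),
    ⟨B + B₁, fun s => (abs_sub _ _).trans (add_le_add (hφ _) (hB₁ _))⟩,
    fun s hs => ?_, fun s hs => ?_⟩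
  · simp only [min_eq_right hs.le, heq c le_rfl hc.le]
  · rcases le_total s c with hsc | hsc
    · simp only [min_eq_left hsc, add_sub_cancel]
    · simp only [min_eq_right hsc, heq c le_rfl hc.le, add_zero, sub_eq_zero.1 (heq s hsc hs)]

theorem slice_congr {K : Set ℝ} {v w : ℝ → ℝ → ℝ} {t : ℝ} (h : EqOn (v t) (w t) K) :
    slice K v t = slice K w t := by
  rw [slice, slice, domRestrict_eq_domRestrict_iff.2 h]

/-- For the smooth part of the boundary values the time derivatives fall on `φ` itself. -/
theorem contDiffOn_slice_halfLineSolution_of_contDiff (n : ℕ) {φ : ℝ → ℝ} (hφ : ContDiff ℝ n φ)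
    (hs : HasCompactSupport φ) :
    ContDiffOn ℝ n (slice (Icc 0 1) fun t x => halfLineSolution φ t (1 - x)) univ := by
  have hcont {φ : ℝ → ℝ} (hφc : Continuous φ) (hs : HasCompactSupport φ) : ContinuousOn
      (fun p : ℝ × ℝ => halfLineSolution φ p.1 (1 - p.2)) (univ ×ˢ Icc 0 1) := by
    obtain ⟨B, hB⟩ := hs.exists_bound_of_continuous hφc
    exact ((continuous_halfLineSolution hφc hB).comp
      (by fun_prop : Continuous fun p : ℝ × ℝ => (p.1, 1 - p.2))).continuousOn
  induction n generalizing φ with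
  | zero => exact contDiffOn_zero.2 (continuousOn_slice (hcont hφ.continuous hs))
  | succ n ih =>
    push_cast at hφ
    obtain ⟨hd, -, hφ'⟩ := contDiff_succ_iff_deriv.1 hφ
    obtain ⟨B, hB⟩ := hs.exists_bound_of_continuous hφ.continuous
    obtain ⟨B', hB'⟩ := hs.deriv.exists_bound_of_continuous hφ'.continuous
    exact contDiffOn_succ_slice convex_univ uniqueDiffOn_univ (hcont hφ.continuous hs)
      (hcont hφ'.continuous hs.deriv) (fun t _ x _ => hasDerivAt_halfLineSolution_fst
        (fun s => (hd s).hasDerivAt) hφ'.continuous.measurable hB hB' t (1 - x)) (ih hφ' hs.deriv)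

/-- After the boundary values have been switched off, the potential is smooth up to `x = 1`. -/
theorem contDiffOn_slice_halfLineSolution_Ioi (n : ℕ) {φ : ℝ → ℝ} {B c : ℝ} (hφm : Measurable φ)
    (hφ : ∀ s, |φ s| ≤ B) (hc : ∀ s, c < s → φ s = 0) :
    ContDiffOn ℝ n (slice (Icc 0 1) fun t x => halfLineSolution φ t (1 - x)) (Ioi c) := by
  have hsupp : tsupport φ ⊆ Iic c := closure_minimal
    (fun s hs => not_lt.1 fun hcs => hs (hc s hcs)) isClosed_Iic
  have hΩ : IsOpen {p : ℝ × ℝ | c < p.1} := isOpen_lt continuous_const continuous_fst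
  have hpot : ContDiffOn ℝ n (fun p : ℝ × ℝ => potential 3 φ (p.1, 1 - p.2)) {p | c < p.1} :=
    (contDiffOn_infty.1 (contDiffOn_potential le_rfl hφm hφ) n).comp
      (f := fun p : ℝ × ℝ => (p.1, 1 - p.2)) (by fun_prop) fun p (hp : c < p.1) hmem =>
        (mem_Iic.1 (hsupp hmem.1)).not_gt hp
  have hcoeff : ContDiff ℝ n fun p : ℝ × ℝ => (1 - p.2) / ∫ s, parabolicKernel 3 (s, 1) :=
    (contDiff_const.sub contDiff_snd).div_const _
  refine (contDiffOn_slice (w := fun t x => (1 - x) / (∫ s, parabolicKernel 3 (s, 1)) *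
    potential 3 φ (t, 1 - x)) (convex_Ioi c) isOpen_Ioi.uniqueDiffOn hΩ (fun p hp => hp.1)
    (hcoeff.contDiffOn.mul hpot)).congr fun t ht => slice_congr fun x hx => ?_
  rcases hx.2.eq_or_lt with rfl | hx1
  · rw [sub_self, halfLineSolution_zero_right, hc t ht, zero_div, zero_mul]
  · exact halfLineSolution_eq_potential φ t (sub_pos.2 hx1)

theorem contDiffOn_slice_halfLineSolution_one_add (n : ℕ) {φ : ℝ → ℝ} {B : ℝ} (hφm : Measurable φ)
    (hφ : ∀ s, |φ s| ≤ B) :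
    ContDiffOn ℝ n (slice (Icc 0 1) fun t x => halfLineSolution φ t (1 + x)) univ := by
  have hΩ : IsOpen {p : ℝ × ℝ | 0 < 1 + p.2} := isOpen_lt continuous_const (by fun_prop)
  refine contDiffOn_slice convex_univ uniqueDiffOn_univ hΩ (fun p hp => ?_)
    ((contDiffOn_infty.1 (contDiffOn_halfLineSolution hφm hφ) n).comp
      (f := fun p : ℝ × ℝ => (p.1, 1 + p.2)) (by fun_prop) fun p hp => hp)
  exact add_pos_of_pos_of_nonneg one_pos hp.2.1

/-- Near a time `t₀` only the boundary values on `(t₀ - 1, 0]` are seen up to `x = 1`, and there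
they are the restriction of a smooth function of compact support. -/
theorem contDiffOn_slice_stripSolution {n : ℕ} {φ : ℝ → ℝ} {B : ℝ} (hφc : Continuous φ)
    (hφ : ∀ s, |φ s| ≤ B) (hφn : ContDiffOn ℝ n φ (Iic 0)) :
    ContDiffOn ℝ n (slice (Icc 0 1) (stripSolution φ)) (Iic 0) := by
  intro t₀ ht₀
  obtain ⟨φ₁, φ₂, hφ₁, hsupp, hφ₂, ⟨C, hC⟩, hzero, hsplit⟩ :=
    exists_eq_add_of_contDiffOn_Iic hφc hφ hφn (c := t₀ - 1) (by linarith [mem_Iic.1 ht₀])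
  obtain ⟨B₁, hB₁⟩ := hsupp.exists_bound_of_continuous hφ₁.continuous
  have happly {ψ : ℝ → ℝ} {D : ℝ} (hψ : Continuous ψ) (hD : ∀ s, |ψ s| ≤ D) (t : ℝ) {f : ℝ → ℝ}
      (hf : Continuous f) (x : Icc (0 : ℝ) 1) :
      slice (Icc 0 1) (fun t x => halfLineSolution ψ t (f x)) t x = halfLineSolution ψ t (f x) :=
    slice_apply (w := fun t x => halfLineSolution ψ t (f x))
      ((continuous_halfLineSolution hψ hD).comp (continuous_const.prodMk hf)).continuousOn x
  have hsub : Continuous fun x : ℝ => 1 - x := by fun_prop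
  have hadd : Continuous fun x : ℝ => 1 + x := by fun_prop
  have hslice (t : ℝ) (ht : t ∈ Iic 0) : slice (Icc 0 1) (stripSolution φ) t
      = slice (Icc 0 1) (fun t x => halfLineSolution φ₁ t (1 - x)) t
        + slice (Icc 0 1) (fun t x => halfLineSolution φ₂ t (1 - x)) t
        + slice (Icc 0 1) (fun t x => halfLineSolution φ t (1 + x)) t := by
    ext x
    have hstrip := (continuous_stripSolution hφc hφ).comp (.prodMk_right t)
    rw [ContinuousMap.add_apply, ContinuousMap.add_apply, slice_apply hstrip.continuousOn,
      happly hφ₁.continuous hB₁ t hsub, happly hφ₂ hC t hsub, happly hφc hφ t hadd, stripSolution,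
      halfLineSolution_congr (fun s hs => hsplit s (hs.trans ht)),
      halfLineSolution_add hφ₁.continuous.measurable hφ₂.measurable hB₁ hC]
  have hnear := (contDiffOn_slice_halfLineSolution_of_contDiff n hφ₁ hsupp) t₀ (mem_univ t₀)
  have hfar := (contDiffOn_slice_halfLineSolution_Ioi n hφ₂.measurable hC hzero).contDiffAt
    (Ioi_mem_nhds (sub_one_lt t₀))
  have hmirror := contDiffOn_slice_halfLineSolution_one_add n hφc.measurable hφ t₀ (mem_univ t₀)
  exact (((hnear.mono (subset_univ _)).add hfar.contDiffWithinAt).add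
    (hmirror.mono (subset_univ _))).congr hslice (hslice t₀ ht₀)

theorem contDiffOn_density {n : ℕ} {φ u : ℝ → ℝ} {γ B y : ℝ} (hφm : Measurable φ)
    (hφ : ∀ s, |φ s| ≤ B) (hy : 0 < y)
    (h : ∀ t ≤ 0, φ t + halfLineSolution φ t y = Real.exp (γ * t) * u t)
    (hu : ContDiffOn ℝ n u (Iic 0)) : ContDiffOn ℝ n φ (Iic 0) := by
  have hsol : ContDiffOn ℝ n (fun t => halfLineSolution φ t y) (Iic 0) :=
    (contDiffOn_infty.1 (contDiffOn_halfLineSolution hφm hφ) n).comp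
      (f := fun t : ℝ => (t, y)) (by fun_prop) fun _ _ => hy
  have hexp : ContDiffOn ℝ n (fun t => Real.exp (γ * t)) (Iic 0) := by fun_prop
  exact ((hexp.mul hu).sub hsol).congr fun t ht => eq_sub_of_add_eq (h t ht)

end SteadyHeat

theorem mainTheorem4_general (γ : ℝ) (u : ℝ → ℝ) (hu : ContinuousOn u (Set.Iic 0))
    (hbdd : ∃ M : ℝ, ∀ t ≤ 0, |Real.exp (γ * t) * u t| ≤ M) :
    ∃ w : ℝ → ℝ → ℝ,
      SteadyHeat.IsClassicalSolution γ u w ∧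
      SteadyHeat.HasL2Bound γ w ∧
      (∀ w' : ℝ → ℝ → ℝ, SteadyHeat.IsClassicalSolution γ u w' → SteadyHeat.HasL2Bound γ w' →
        ∀ t ≤ 0, ∀ x ∈ Set.Icc (0 : ℝ) 1, w' t x = w t x) ∧
      (∀ t ≤ 0, w t ∈ SteadyHeat.spaceA) ∧
      (SteadyHeat.MemC1C2 w 1 ↔ ContDiffOn ℝ 2 u (Set.Iic 0)) := by
  obtain ⟨M, hM⟩ := hbdd
  have hu' : Continuous fun t => u (min t 0) :=
    hu.comp_continuous (by fun_prop) fun t => min_le_right t 0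
  have hg : Continuous fun t => Real.exp (γ * min t 0) * u (min t 0) :=
    (by fun_prop : Continuous fun t => Real.exp (γ * min t 0)).mul hu'
  obtain ⟨φ, hφc, ⟨B, hφ⟩, hφg⟩ := SteadyHeat.exists_add_halfLineSolution_eq two_ne_zero hg
    fun t => hM _ (min_le_right t 0)
  have hφu (t : ℝ) (ht : t ≤ 0) : φ t + SteadyHeat.halfLineSolution φ t 2
      = Real.exp (γ * t) * u t := by rw [hφg t, min_eq_left ht]
  have hsol := SteadyHeat.isClassicalSolution_dampedSolution hφc hφ hφu
  have hL2 := SteadyHeat.hasL2Bound_dampedSolution γ hφ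
  refine ⟨SteadyHeat.dampedSolution γ φ, hsol, hL2,
    fun w' hw' hb' t ht => hsol.eqOn_of_hasL2Bound hL2 hw' hb' ht,
    fun t _ => SteadyHeat.dampedSolution_mem_spaceA γ hφc hφ t,
    hsol.contDiffOn_of_memC1C2_one, fun hu2 => ?_⟩
  exact SteadyHeat.memC1C2_dampedSolution γ hφc hφ one_pos le_rfl
    (SteadyHeat.contDiffOn_slice_stripSolution hφc hφ
      (SteadyHeat.contDiffOn_density hφc.measurable hφ two_pos hφu hu2))

theorem mainTheorem4 (γ : ℝ) (hγ : 0 < γ) (u : ℝ → ℝ) (hu : ContinuousOn u (Set.Iic 0))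
    (hbdd : ∃ M : ℝ, ∀ t ≤ 0, |Real.exp (γ * t) * u t| ≤ M) :
    ∃ w : ℝ → ℝ → ℝ,
      SteadyHeat.IsClassicalSolution γ u w ∧
      SteadyHeat.HasL2Bound γ w ∧
      (∀ w' : ℝ → ℝ → ℝ, SteadyHeat.IsClassicalSolution γ u w' → SteadyHeat.HasL2Bound γ w' →
        ∀ t ≤ 0, ∀ x ∈ Set.Icc (0 : ℝ) 1, w' t x = w t x) ∧
      (∀ t ≤ 0, w t ∈ SteadyHeat.spaceA) ∧
      (SteadyHeat.MemC1C2 w 1 ↔ ContDiffOn ℝ 2 u (Set.Iic 0)) :=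
  mainTheorem4_general γ u hu hbdd
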